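/- All graphs are finite, simple, undirected and without isolated vertices; $K_{1,n}$ is the star with $n$ edges, $kH$ is the disjoint union of $k$ copies of $H$, and $\sqcup$ is disjoint union. Write $G\to(F_1,F_2)$ if every red-blue colouring of the edges of $G$ contains a red copy of $F_1$ or a blue copy of $F_2$ (copies need not be induced); let $e(G)$ be the number of edges of $G$, and let $\hat r(F_1,F_2)$ be the minimum of $e(G)$ over all graphs $G$ with $G\to(F_1,F_2)$. Let $s,t,m,n$ be positive integers with $n\ge m$. Then $$\hat r(sK_{1,n},tK_{1,m})=(s+t-1)(m+n-1).$$ Moreover, a graph $G$ satisfies $G\to(sK_{1,n},tK_{1,m})$ and $e(G)=(s+t-1)(m+n-1)$ if and only if, up to isomorphism, one of the following holds: 1. $G=(s+t-1)K_{1,n+m-1}$; 2. $n=m=2$ and $G=lK_3\sqcup(s+t-1-l)K_{1,3}$ for some integer $0\le l\le s+t-1$; 3. $s=m=1$, $n=2$ and $G=lC_4\sqcup(t-2l)K_{1,2}$ for some integer $0\le l\le t/2$. -/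

import Mathlib

open scoped SimpleGraph

namespace SizeRamsey

/-- The star `K_{1,n}`, with one root and `n` leaves. -/
abbrev star (n : ℕ) : SimpleGraph (Fin 1 ⊕ Fin n) :=
  completeBipartiteGraph (Fin 1) (Fin n)

/-- `copies k H` is `kH`, the disjoint union of `k` copies of `H`. -/
def copies {W : Type*} (k : ℕ) (H : SimpleGraph W) : SimpleGraph (Fin k × W) where
  Adj x y := x.1 = y.1 ∧ H.Adj x.2 y.2
  symm := ⟨fun _ _ h => ⟨h.1.symm, h.2.symm⟩⟩
  loopless := ⟨fun x h => H.loopless.irrefl x.2 h.2⟩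

/-- `G → (F₁, F₂)`: every colouring of the edges of `G` in red (`true`) and blue (`false`) has a
red copy of `F₁` or a blue copy of `F₂` (copies need not be induced). -/
def Arrows {V W₁ W₂ : Type*} (G : SimpleGraph V) (F₁ : SimpleGraph W₁) (F₂ : SimpleGraph W₂) :
    Prop :=
  ∀ C : G.EdgeLabeling Bool, F₁ ⊑ C.labelGraph true ∨ F₂ ⊑ C.labelGraph false

/-- The size Ramsey number of `(F₁, F₂)`: the least number of edges of a finite graph `G` with
`G → (F₁, F₂)`. (The value is `0` if there is no such `G`, so a positive value is attained.) -/
noncomputable def sizeRamseyNumber {W₁ W₂ : Type*} (F₁ : SimpleGraph W₁) (F₂ : SimpleGraph W₂) :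
    ℕ :=
  sInf {k | ∃ (N : ℕ) (G : SimpleGraph (Fin N)), Arrows G F₁ F₂ ∧ G.edgeSet.ncard = k}

end SizeRamsey

/-! Write `N = n + m - 1` and `k = s + t - 1`. A star with `N` edges has `n` red or `m` blue edges,
so `k` disjoint stars arrow and have `k * N` edges. The lower bound is by induction on `k`.

If some vertex `v` has degree at least `N`, give all edges at `v` one colour. At most one of several
disjoint stars of that colour uses `v` and no star of the other colour does, so `G - v` arrows with
`s` or `t` lowered by one (`ArrowsStars.del_vertex`), while at least `N` edges are lost. For `s = t
= 1` the degree of `v` is already enough.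

If all degrees are below `N`, Vizing's theorem gives a proper edge colouring with `N` colours. Fix a
colour `a`, make `n - 1` other colours red and the remaining `m - 1` blue. A red `K_{1,n}` then
needs a red edge of colour `a`, a blue `K_{1,m}` a blue one. If the class of `a` had fewer than `k`
edges, one could make at most `s - 1` of them red and at most `t - 1` blue, against arrowing. So
each of the `N` classes has at least `k` edges.

Equality without vertices of degree `N`: all classes have exactly `k` edges, in every proper
colouring. An edge of colour `a` whose ends miss colours that can be put among the red ones lies in
no red star and need not be counted. This forces `n = m = 2` and, after exchanging colours of
adjacent edges, triangle components (`exists_triangleAt`).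

Equality with such vertices: the maximum degree is `N`, and `G - v` is extremal for each `v` of
degree `N`. Comparing `G - v` with `G - c` for a second vertex `c`, the component of `v` is a star
unless a few vertices carrying more than `N` edges can be removed at the cost of one star
(`del_small`, `del_pair`), which contradicts the lower bound. The one exception, for `n = 2` and `m
= 1`, is the four-cycle; it is excluded by the same count when `s ≥ 2` (`not_fourCycleAt`). -/

namespace SizeRamsey

/-! ### Vizing's theorem -/

section Vizing

variable {V K : Type*}

/-- A proper colouring of some of the edges of the complete graph on `V`. -/
structure PartialEdgeColoring (V K : Type*) where
  color : V → V → Option K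
  symm : ∀ u v, color u v = color v u
  irrefl : ∀ u, color u u = none
  proper : ∀ u v w a, color u v = some a → color u w = some a → v = w

namespace PartialEdgeColoring

/-- The colour `a` does not appear at `v`. -/
def Missing (c : PartialEdgeColoring V K) (v : V) (a : K) : Prop :=
  ∀ w, c.color v w ≠ some a

open Classical in
/-- Delete the colour of an edge. -/
noncomputable def erase (c : PartialEdgeColoring V K) (x y : V) : PartialEdgeColoring V K where
  color u v := if (u = x ∧ v = y) ∨ (u = y ∧ v = x) then none else c.color u v
  symm u v := by have := c.symm u v; grind
  irrefl u := by have := c.irrefl u; grind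
  proper u v w a := by have := c.proper u v w a; grind

open Classical in
/-- Give an edge a colour that is missing at both ends. -/
noncomputable def insert (c : PartialEdgeColoring V K) (x y : V) (a : K) (hxy : x ≠ y)
    (hx : c.Missing x a) (hy : c.Missing y a) : PartialEdgeColoring V K where
  color u v := if (u = x ∧ v = y) ∨ (u = y ∧ v = x) then some a else c.color u v
  symm u v := by have := c.symm u v; grind
  irrefl u := by have := c.irrefl u; grind
  proper u v w b := by
    have := c.proper u v w b
    unfold Missing at hx hy
    grind

open Classical in
/-- Exchange two colours on a set of vertices that is a union of components of the graph formed by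
these colours. -/
noncomputable def swap (c : PartialEdgeColoring V K) (a b : K) (S : Set V)
    (hS : ∀ u v, u ∈ S → (c.color u v = some a ∨ c.color u v = some b) → v ∈ S) :
    PartialEdgeColoring V K where
  color u v := if u ∈ S then (c.color u v).map (Equiv.swap a b) else c.color u v
  symm u v := by
    have key : ∀ u v, u ∈ S → v ∉ S → (c.color u v).map (Equiv.swap a b) = c.color u v := by
      intro u v hu hv
      cases h : c.color u v with
      | none => rfl
      | some d =>
        have := hS u v hu
        rw [Option.map_some, Equiv.swap_apply_of_ne_of_ne] <;> grind
    have h1 := c.symm u v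
    have h2 := key u v
    have h3 := key v u
    grind
  irrefl u := by simp [c.irrefl u]
  proper u v w d hv hw := by
    split_ifs at hv hw with h
    · rw [Option.map_eq_some_iff] at hv hw
      obtain ⟨d1, h1, h1'⟩ := hv
      obtain ⟨d2, h2, h2'⟩ := hw
      have : d1 = d2 := (Equiv.swap a b).injective (h1'.trans h2'.symm)
      subst this
      exact c.proper u v w d1 h1 h2
    · exact c.proper u v w d hv hw

/-- Shifting a fan: `x y₀` takes the colour of `x y₁`, which is missing at `y₀`, and `x y₁` becomes
the uncoloured edge. After `k` shifts the last edge takes the colour `a`, missing at both its ends.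
-/
theorem exists_insert_of_fan (k : ℕ) : ∀ (c : PartialEdgeColoring V K) (x : V) (y : ℕ → V) (a : K),
    (∀ i ≤ k, x ≠ y i) → (∀ i ≤ k, ∀ j ≤ k, y i = y j → i = j) → c.color x (y 0) = none →
    (∀ i < k, ∃ b, c.color x (y (i + 1)) = some b ∧ c.Missing (y i) b) →
    c.Missing x a → c.Missing (y k) a →
    ∃ c' : PartialEdgeColoring V K, ∀ u v, c'.color u v ≠ none ↔
      c.color u v ≠ none ∨ (u = x ∧ v = y 0) ∨ (u = y 0 ∧ v = x) := by
  induction k with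
  | zero =>
    intro c x y a hx _ _ _ ha hb
    refine ⟨c.insert x (y 0) a (hx 0 le_rfl) ha hb, fun u v => ?_⟩
    simp only [insert]
    grind
  | succ k ih =>
    intro c x y a hx hinj h0 hfan ha hb
    obtain ⟨b, hb1, hb2⟩ := hfan 0 (by omega)
    have h01 : y 0 ≠ y 1 := fun h => by simpa using hinj 0 (by omega) 1 (by omega) h
    have hsymm := c.symm
    have hmx : (c.erase x (y 1)).Missing x b := by
      intro w hw
      have := c.proper x w (y 1) b
      simp only [erase] at hw
      grind
    have hmy : (c.erase x (y 1)).Missing (y 0) b := by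
      intro w hw
      have := hb2 w
      simp only [erase] at hw
      grind
    have hx0 := hx 0 (by omega)
    have hx1 := hx 1 (by omega)
    obtain ⟨c', hc'⟩ := ih ((c.erase x (y 1)).insert x (y 0) b hx0 hmx hmy) x
      (fun i => y (i + 1)) a (fun i hi => hx _ (by omega))
      (fun i hi j hj h => by simpa using hinj _ (by omega) _ (by omega) h)
      (by simp only [insert, erase]; grind)
      (by
        intro i hi
        obtain ⟨d, hd1, hd2⟩ := hfan (i + 1) (by omega)
        refine ⟨d, ?_, ?_⟩
        · have h1 := hinj (i + 1 + 1) (by omega) 0 (by omega)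
          have h2 := hinj (i + 1 + 1) (by omega) 1 (by omega)
          have h3 := hx (i + 1 + 1) (by omega)
          simp only [insert, erase]
          grind
        · intro w hw
          have h1 := hinj (i + 1) (by omega) 0 (by omega)
          have h3 := hx (i + 1) (by omega)
          have := hd2 w
          simp only [insert, erase] at hw
          grind)
      (by
        intro w hw
        have := ha w
        have := ha (y 1)
        simp only [insert, erase] at hw
        grind)
      (by
        intro w hw
        have h1 := hinj (k + 1) (by omega) 0 (by omega)
        have h3 := hx (k + 1) (by omega)
        have := hb w
        simp only [insert, erase] at hw
        grind)
    refine ⟨c', fun u v => (hc' u v).trans ?_⟩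
    simp only [insert, erase]
    grind

end PartialEdgeColoring

/-- In a graph of maximum degree two, three vertices of degree at most one cannot lie in the same
component. -/
theorem not_reachable_of_degree_le [Finite V] (H : SimpleGraph V)
    (h2 : ∀ v, (H.neighborSet v).ncard ≤ 2) {x y z : V} (hxy : x ≠ y) (hxz : x ≠ z) (hyz : y ≠ z)
    (hx : (H.neighborSet x).ncard ≤ 1) (hy : (H.neighborSet y).ncard ≤ 1)
    (hz : (H.neighborSet z).ncard ≤ 1) : ¬ (H.Reachable x y ∧ H.Reachable x z) := by
  classical
  rintro ⟨hry, hrz⟩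
  have := Fintype.ofFinite V
  set C := H.connectedComponentMk x with hC
  have hconn : C.toSimpleGraph.Connected := C.connected_toSimpleGraph
  have h1 := hconn.card_vert_le_card_edgeSet_add_one
  rw [Nat.card_eq_fintype_card, Nat.card_eq_fintype_card, ← SimpleGraph.edgeFinset_card] at h1
  have h3 := C.toSimpleGraph.sum_degrees_eq_twice_card_edges
  have hdeg : ∀ v : C, C.toSimpleGraph.degree v ≤ (H.neighborSet v.1).ncard := by
    intro v
    rw [← SimpleGraph.card_neighborSet_eq_degree, ← Nat.card_eq_fintype_card,
      Nat.card_coe_set_eq, ← Set.ncard_image_of_injective _ Subtype.val_injective]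
    apply Set.ncard_le_ncard _ (Set.toFinite _)
    rintro _ ⟨w, hw, rfl⟩
    simpa [SimpleGraph.ConnectedComponent.toSimpleGraph] using hw
  have hxC : x ∈ C := SimpleGraph.ConnectedComponent.connectedComponentMk_mem
  have hyC : y ∈ C := (SimpleGraph.ConnectedComponent.mem_supp_iff _ _).2
    (SimpleGraph.ConnectedComponent.sound hry.symm)
  have hzC : z ∈ C := (SimpleGraph.ConnectedComponent.mem_supp_iff _ _).2
    (SimpleGraph.ConnectedComponent.sound hrz.symm)
  -- Summed over the component this gives `2|E| + 3 ≤ 2|C|`, whereas connectedness gives `|C| ≤ |E|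
  -- + 1`.
  have hle : ∀ v : C, C.toSimpleGraph.degree v +
      ((if v = ⟨x, hxC⟩ then 1 else 0) + (if v = ⟨y, hyC⟩ then 1 else 0) +
        (if v = ⟨z, hzC⟩ then 1 else 0)) ≤ 2 := by
    intro v
    have := hdeg v
    have := h2 v
    grind
  have h4 := Finset.sum_le_sum fun v (_ : v ∈ Finset.univ) => hle v
  rw [Finset.sum_add_distrib, Finset.sum_add_distrib, Finset.sum_add_distrib, h3] at h4
  simp only [Finset.sum_ite_eq', Finset.mem_univ, if_true, Finset.sum_const, Finset.card_univ,
    smul_eq_mul] at h4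
  omega

namespace PartialEdgeColoring

theorem missing_swap_left (c : PartialEdgeColoring V K) {a b : K} {S : Set V}
    (hS : ∀ u v, u ∈ S → (c.color u v = some a ∨ c.color u v = some b) → v ∈ S) {v : V}
    (hv : v ∈ S) (h : c.Missing v b) : (c.swap a b S hS).Missing v a := by
  classical
  intro w hw
  simp only [swap, if_pos hv, Option.map_eq_some_iff] at hw
  obtain ⟨d, hd, hd'⟩ := hw
  rw [Equiv.swap_apply_eq_iff, Equiv.swap_apply_left] at hd'
  exact h w (hd' ▸ hd)

theorem missing_swap_of_notMem (c : PartialEdgeColoring V K) {a b d : K} {S : Set V}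
    (hS : ∀ u v, u ∈ S → (c.color u v = some a ∨ c.color u v = some b) → v ∈ S) {v : V}
    (hv : v ∉ S) (h : c.Missing v d) : (c.swap a b S hS).Missing v d := by
  intro w hw
  simp only [swap, if_neg hv] at hw
  exact h w hw

theorem missing_swap_of_ne (c : PartialEdgeColoring V K) {a b d : K} {S : Set V}
    (hS : ∀ u v, u ∈ S → (c.color u v = some a ∨ c.color u v = some b) → v ∈ S) {v : V}
    (hda : d ≠ a) (hdb : d ≠ b) (h : c.Missing v d) : (c.swap a b S hS).Missing v d := by
  classical
  intro w hw
  simp only [swap] at hw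
  split_ifs at hw
  · rw [Option.map_eq_some_iff] at hw
    obtain ⟨e, he, he'⟩ := hw
    rw [Equiv.swap_apply_eq_iff, Equiv.swap_apply_of_ne_of_ne hda hdb] at he'
    exact h w (he' ▸ he)
  · exact h w hw

theorem swap_ne_none_iff (c : PartialEdgeColoring V K) {a b : K} {S : Set V}
    (hS : ∀ u v, u ∈ S → (c.color u v = some a ∨ c.color u v = some b) → v ∈ S) (u v : V) :
    (c.swap a b S hS).color u v ≠ none ↔ c.color u v ≠ none := by
  simp only [swap]
  split_ifs <;> simp

/-- The graph formed by the edges of two colours. -/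
def twoColorGraph (c : PartialEdgeColoring V K) (a b : K) : SimpleGraph V where
  Adj u v := c.color u v = some a ∨ c.color u v = some b
  symm := ⟨fun u v h => by rwa [c.symm v u]⟩
  loopless := ⟨fun u h => by simp [c.irrefl u] at h⟩

theorem ncard_color_le (c : PartialEdgeColoring V K) (v : V) (a : K) :
    {w | c.color v w = some a}.ncard ≤ 1 := by
  have hs : {w | c.color v w = some a}.Subsingleton := fun x hx y hy => c.proper v x y a hx hy
  exact (Set.ncard_le_one hs.finite).2 fun x hx y hy => hs hx hy

theorem ncard_twoColorGraph_le (c : PartialEdgeColoring V K) (a b : K) (v : V) :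
    ((c.twoColorGraph a b).neighborSet v).ncard ≤ 2 :=
  calc ((c.twoColorGraph a b).neighborSet v).ncard
      = ({w | c.color v w = some a} ∪ {w | c.color v w = some b}).ncard := rfl
    _ ≤ _ := Set.ncard_union_le _ _
    _ ≤ 1 + 1 := add_le_add (c.ncard_color_le v a) (c.ncard_color_le v b)

theorem ncard_twoColorGraph_le_one (c : PartialEdgeColoring V K) {a b : K} {v : V}
    (h : c.Missing v a ∨ c.Missing v b) : ((c.twoColorGraph a b).neighborSet v).ncard ≤ 1 := by
  rcases h with h | h
  · convert c.ncard_color_le v b using 2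
    ext w
    simp [twoColorGraph, h w]
  · convert c.ncard_color_le v a using 2
    ext w
    simp [twoColorGraph, h w]

/-- Vizing's fan argument: an uncoloured edge can be coloured as soon as some colour is missing at
every vertex. -/
theorem exists_insert [Finite V] (c : PartialEdgeColoring V K) (hc : ∀ v, ∃ a, c.Missing v a)
    {x y₀ : V} (hxy : x ≠ y₀) (h0 : c.color x y₀ = none) :
    ∃ c' : PartialEdgeColoring V K, ∀ u v, c'.color u v ≠ none ↔
      c.color u v ≠ none ∨ (u = x ∧ v = y₀) ∨ (u = y₀ ∧ v = x) := by
  classical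
  have := Fintype.ofFinite V
  let P : ℕ → Prop := fun k => ∃ y : ℕ → V, y 0 = y₀ ∧ (∀ i ≤ k, x ≠ y i) ∧
    (∀ i ≤ k, ∀ j ≤ k, y i = y j → i = j) ∧
    (∀ i < k, ∃ b, c.color x (y (i + 1)) = some b ∧ c.Missing (y i) b)
  have hP0 : P 0 := ⟨fun _ => y₀, rfl, fun _ _ => hxy, by simp, by simp⟩
  have hbound : ∀ k, P k → k ≤ Fintype.card V := by
    rintro k ⟨y, -, -, hinj, -⟩
    have : Function.Injective fun i : Fin (k + 1) => y i := fun i j h =>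
      Fin.ext (hinj i (by omega) j (by omega) h)
    have := Fintype.card_le_of_injective _ this
    rw [Fintype.card_fin] at this
    omega
  set k := Nat.findGreatest P (Fintype.card V) with hk
  have hPk : P k := Nat.findGreatest_spec (P := P) (Nat.zero_le _) hP0
  have hmax : ¬ P (k + 1) := fun h => by
    have := Nat.le_findGreatest (P := P) (hbound _ h) h
    omega
  obtain ⟨y, rfl, hx, hinj, hfan⟩ := hPk
  obtain ⟨a, ha⟩ := hc x
  obtain ⟨b, hb⟩ := hc (y k)
  by_cases hxb : c.Missing x b
  · exact c.exists_insert_of_fan k x y b hx hinj h0 hfan hxb hb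
  obtain ⟨z, hz⟩ : ∃ z, c.color x z = some b := by
    unfold Missing at hxb
    push Not at hxb
    exact hxb
  have hab : a ≠ b := fun h => ha z (h ▸ hz)
  -- A `z` outside the fan could be appended to it, since the colour `b` of `x z` is missing at `y
  -- k`; the fan is maximal.
  have hz' : ∃ i ≤ k, z = y i := by
    by_contra! hne
    refine hmax ⟨fun i => if i ≤ k then y i else z, by simp, ?_, ?_, ?_⟩
    · intro i hi
      have := hx i
      have := c.irrefl x
      grind
    · intro i hi j hj hij
      have := hne i
      have := hne j
      have := hinj i
      grind
    · intro i hi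
      by_cases hik : i < k
      · simpa [hik, hik.le, Nat.succ_le_of_lt hik] using hfan i hik
      · obtain rfl : i = k := by omega
        exact ⟨b, by simpa using hz, by simpa using hb⟩
  obtain ⟨i, hik, rfl⟩ := hz'
  -- The index is not zero because `x (y 0)` is uncoloured.
  obtain ⟨j, rfl⟩ : ∃ j, i = j + 1 := Nat.exists_eq_succ_of_ne_zero (by rintro rfl; simp_all)
  have hjb : c.Missing (y j) b := by
    obtain ⟨d, hd1, hd2⟩ := hfan j (by omega)
    rw [hz] at hd1
    exact (Option.some.inj hd1) ▸ hd2
  set H := c.twoColorGraph a b with hH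
  have hjk : y j ≠ y k := fun h => by have := hinj j (by omega) k le_rfl h; omega
  have hclosed : ∀ r u v, u ∈ {w | H.Reachable r w} →
      (c.color u v = some a ∨ c.color u v = some b) → v ∈ {w | H.Reachable r w} :=
    fun r u v hu huv => SimpleGraph.Reachable.trans hu (SimpleGraph.Adj.reachable huv)
  -- Each of `x`, `y j`, `y k` misses `a` or `b`, so they do not all lie in one two-coloured chain.
  -- If the chain of `x` contains `y j`, swapping along the chain of `y k` frees `a` at `y k` and
  -- the whole fan shifts; otherwise swapping along the chain of `y j` frees `a` at `y j` and the
  -- fan shifts up to `y j`.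
  by_cases hr : H.Reachable x (y j)
  · have hr' : ¬ H.Reachable x (y k) := fun h =>
      not_reachable_of_degree_le H (c.ncard_twoColorGraph_le a b) (hx j (by omega)) (hx k le_rfl)
        hjk (c.ncard_twoColorGraph_le_one (Or.inl ha)) (c.ncard_twoColorGraph_le_one (Or.inr hjb))
        (c.ncard_twoColorGraph_le_one (Or.inr hb)) ⟨hr, h⟩
    set S := {w | H.Reachable (y k) w} with hS
    have hxS : x ∉ S := fun h => hr' h.symm
    have hjS : y j ∉ S := fun h => hr' (hr.trans h.symm)
    obtain ⟨c', hc'⟩ := (c.swap a b S (hclosed _)).exists_insert_of_fan k x y a hx hinj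
      (by simp [swap, hxS, h0]) (by
        intro i hi
        obtain ⟨d, hd1, hd2⟩ := hfan i hi
        refine ⟨d, by simp [swap, hxS, hd1], ?_⟩
        have hda : d ≠ a := fun h => ha _ (h ▸ hd1)
        -- In the fan the colour `b` occurs only on `x (y (j + 1))`, so it matters only at `y j`,
        -- which lies outside `S`.
        by_cases hdb : d = b
        · subst hdb
          have := hinj _ (by omega) _ (by omega) (c.proper x _ _ d hd1 hz)
          obtain rfl : i = j := by omega
          exact c.missing_swap_of_notMem _ hjS hd2
        · exact c.missing_swap_of_ne _ hda hdb hd2)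
      (c.missing_swap_of_notMem _ hxS ha)
      (c.missing_swap_left _ (SimpleGraph.Reachable.refl _) hb)
    exact ⟨c', fun u v => by rw [hc', swap_ne_none_iff]⟩
  · set S := {w | H.Reachable (y j) w} with hS
    have hxS : x ∉ S := fun h => hr h.symm
    obtain ⟨c', hc'⟩ := (c.swap a b S (hclosed _)).exists_insert_of_fan j x y a
      (fun i hi => hx i (by omega)) (fun i hi l hl => hinj i (by omega) l (by omega))
      (by simp [swap, hxS, h0]) (by
        intro i hi
        obtain ⟨d, hd1, hd2⟩ := hfan i (by omega)
        refine ⟨d, by simp [swap, hxS, hd1], ?_⟩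
        have hda : d ≠ a := fun h => ha _ (h ▸ hd1)
        by_cases hdb : d = b
        · subst hdb
          have := hinj _ (by omega) _ (by omega) (c.proper x _ _ d hd1 hz)
          omega
        · exact c.missing_swap_of_ne _ hda hdb hd2)
      (c.missing_swap_of_notMem _ hxS ha)
      (c.missing_swap_left _ (SimpleGraph.Reachable.refl _) hjb)
    exact ⟨c', fun u v => by rw [hc', swap_ne_none_iff]⟩

/-- A colour is missing at a vertex with fewer coloured edges than there are colours. -/
theorem exists_missing [Finite V] [Finite K] (c : PartialEdgeColoring V K) (v : V)
    (h : {w | c.color v w ≠ none}.ncard < Nat.card K) : ∃ a, c.Missing v a := by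
  by_contra! hne
  unfold Missing at hne
  push Not at hne
  choose f hf using hne
  refine h.not_ge ?_
  rw [← Set.ncard_univ]
  refine Set.ncard_le_ncard_of_injOn f (fun a _ => by simp [hf a]) (fun a _ b _ hab => ?_)
    (Set.toFinite _)
  exact Option.some.inj ((hf a).symm.trans (hab ▸ hf b))

end PartialEdgeColoring

/-- **Vizing's theorem**: the edges of a graph with all degrees less than `|K|` can be properly
coloured with colours from `K`. -/
theorem exists_edgeColoring_of_degree_lt [Finite V] [Finite K] (G : SimpleGraph V)
    (h : ∀ v, (G.neighborSet v).ncard < Nat.card K) :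
    ∃ c : PartialEdgeColoring V K, ∀ u v, c.color u v ≠ none ↔ G.Adj u v := by
  suffices H : ∀ E : Finset (Sym2 V), (∀ e ∈ E, e ∈ G.edgeSet) →
      ∃ c : PartialEdgeColoring V K, ∀ u v, c.color u v ≠ none ↔ s(u, v) ∈ E by
    obtain ⟨c, hc⟩ := H (Set.toFinite G.edgeSet).toFinset (by simp)
    exact ⟨c, fun u v => by simp [hc]⟩
  classical
  intro E
  induction E using Finset.induction_on with
  | empty => exact fun _ => ⟨⟨fun _ _ => none, by simp, by simp, by simp⟩, by simp⟩
  | insert e E he ih =>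
    intro hE
    obtain ⟨c, hc⟩ := ih fun e' he' => hE e' (Finset.mem_insert_of_mem he')
    induction e using Sym2.inductionOn with
    | _ x y =>
    have hxy : G.Adj x y := hE _ (Finset.mem_insert_self _ _)
    obtain ⟨c', hc'⟩ := c.exists_insert (x := x) (y₀ := y) (fun v => c.exists_missing v
      (lt_of_le_of_lt (Set.ncard_le_ncard (fun w hw => hE _ (Finset.mem_insert_of_mem
        ((hc v w).1 hw))) (Set.toFinite _)) (h v))) hxy.ne
      (by by_contra hne; exact he ((hc x y).1 hne))
    refine ⟨c', fun u v => ?_⟩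
    rw [hc', hc, Finset.mem_insert, Sym2.eq_iff]
    tauto

end Vizing
/-! ### Star forests and arrowing -/

section Stars

variable {V W : Type*}

/-- `c` is joined in `R` to the `n` vertices in `L`. -/
structure IsStar (R : SimpleGraph V) (n : ℕ) (c : V) (L : Finset V) : Prop where
  card : L.card = n
  adj : ∀ l ∈ L, R.Adj c l

/-- The vertices of the star with centre `c` and set of leaves `L`. -/
def starVerts (c : V) (L : Finset V) : Set V := insert c (L : Set V)

/-- `R` contains disjoint stars with `n` leaves indexed by `ι`. -/
def HasStars (R : SimpleGraph V) (n : ℕ) (ι : Type*) : Prop :=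
  ∃ (c : ι → V) (L : ι → Finset V), (∀ i, IsStar R n (c i) (L i)) ∧
    ∀ i j, i ≠ j → Disjoint (starVerts (c i) (L i)) (starVerts (c j) (L j))

theorem HasStars.of_injective {R : SimpleGraph V} {n : ℕ} {ι κ : Type*} (h : HasStars R n ι)
    {f : κ → ι} (hf : Function.Injective f) : HasStars R n κ := by
  obtain ⟨c, L, h1, h2⟩ := h
  exact ⟨c ∘ f, L ∘ f, fun i => h1 _, fun i j hij => h2 _ _ (hf.ne hij)⟩

theorem starVerts_map (f : V ↪ W) (c : V) (L : Finset V) :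
    starVerts (f c) (L.map f) = f '' starVerts c L := by
  simp [starVerts, Set.image_insert_eq]

theorem IsStar.map {R : SimpleGraph V} {R' : SimpleGraph W} {n : ℕ} {c : V} {L : Finset V}
    (h : IsStar R n c L) (f : V ↪ W) (hf : ∀ a b, R.Adj a b → R'.Adj (f a) (f b)) :
    IsStar R' n (f c) (L.map f) := by
  refine ⟨by rw [Finset.card_map, h.card], fun l hl => ?_⟩
  obtain ⟨a, ha, rfl⟩ := Finset.mem_map.1 hl
  exact hf _ _ (h.adj a ha)

theorem HasStars.map {R : SimpleGraph V} {R' : SimpleGraph W} {n : ℕ} {ι : Type*}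
    (h : HasStars R n ι) (f : V ↪ W) (hf : ∀ a b, R.Adj a b → R'.Adj (f a) (f b)) :
    HasStars R' n ι := by
  obtain ⟨c, L, h1, h2⟩ := h
  refine ⟨fun i => f (c i), fun i => (L i).map f, fun i => (h1 i).map f hf, fun i j hij => ?_⟩
  rw [starVerts_map, starVerts_map, Set.disjoint_image_iff f.injective]
  exact h2 i j hij

theorem copies_star_isContained_iff (R : SimpleGraph V) (n s : ℕ) :
    copies s (star n) ⊑ R ↔ HasStars R n (Fin s) := by
  classical
  constructor
  · rintro ⟨f⟩
    refine ⟨fun i => f (i, Sum.inl 0), fun i => Finset.univ.image fun j => f (i, Sum.inr j),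
      fun i => ⟨?_, fun l hl => ?_⟩, fun i j hij => ?_⟩
    · rw [Finset.card_image_of_injective _ fun a b h => by simpa using f.injective h]
      simp
    · obtain ⟨j, -, rfl⟩ := Finset.mem_image.1 hl
      exact f.toHom.map_adj ⟨rfl, by simp⟩
    · have : ∀ i, starVerts (f (i, Sum.inl 0)) (Finset.univ.image fun j => f (i, Sum.inr j)) ⊆
          f '' {x | x.1 = i} := by
        rintro i _ (rfl | h)
        · exact ⟨_, rfl, rfl⟩
        · obtain ⟨j, -, rfl⟩ := Finset.mem_image.1 h
          exact ⟨_, rfl, rfl⟩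
      refine Disjoint.mono (this i) (this j) ((Set.disjoint_image_iff f.injective).2 ?_)
      rw [Set.disjoint_left]
      rintro x rfl h
      exact hij h
  · rintro ⟨c, L, h1, h2⟩
    have e : ∀ i, Fin n ≃ L i := fun i => (Finset.equivFinOfCardEq (h1 i).card).symm
    let f : Fin s × (Fin 1 ⊕ Fin n) → V := fun x => Sum.elim (fun _ => c x.1) (fun j => e x.1 j) x.2
    have hadj : ∀ i j, R.Adj (c i) (e i j) := fun i j => (h1 i).adj _ (e i j).2
    have hmem : ∀ x, f x ∈ starVerts (c x.1) (L x.1) := by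
      rintro ⟨i, j | j⟩
      · exact Or.inl rfl
      · exact Or.inr (e i j).2
    refine ⟨⟨⟨f, ?_⟩, ?_⟩⟩
    · rintro ⟨i, a | a⟩ ⟨j, b | b⟩ ⟨h, h'⟩ <;> obtain rfl : i = j := h
      · simp at h'
      · exact hadj i b
      · exact (hadj i a).symm
      · simp at h'
    · intro x y hxy
      change f x = f y at hxy
      have hij : x.1 = y.1 := by
        by_contra hne
        exact Set.disjoint_left.1 (h2 _ _ hne) (hmem x) (hxy ▸ hmem y)
      obtain ⟨i, a | a⟩ := x <;> obtain ⟨j, b | b⟩ := y <;> obtain rfl : i = j := hij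
      · rw [Subsingleton.elim a b]
      · exact absurd hxy (hadj i b).ne
      · exact absurd hxy (hadj i a).ne'
      · rw [(e i).injective (Subtype.ext hxy)]

/-- `G → (sK_{1,n}, tK_{1,m})`, in terms of the graph of red edges. -/
def ArrowsStars (G : SimpleGraph V) (n m s t : ℕ) : Prop :=
  ∀ R ≤ G, HasStars R n (Fin s) ∨ HasStars (G \ R) m (Fin t)

theorem arrows_iff (G : SimpleGraph V) (n m s t : ℕ) :
    Arrows G (copies s (star n)) (copies t (star m)) ↔ ArrowsStars G n m s t := by
  classical
  simp only [Arrows, copies_star_isContained_iff]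
  constructor
  · intro h R hR
    let C : G.EdgeLabeling Bool := fun e => decide (e.1 ∈ R.edgeSet)
    have h1 : C.labelGraph true = R := by
      ext x y
      rw [SimpleGraph.EdgeLabeling.labelGraph_adj]
      simp only [C, decide_eq_true_eq, SimpleGraph.mem_edgeSet, exists_prop, and_iff_right_iff_imp]
      exact fun h => hR h
    have h2 : C.labelGraph false = G \ R := by
      ext x y
      rw [SimpleGraph.EdgeLabeling.labelGraph_adj]
      simp [C]
    have h3 := h C
    rwa [h1, h2] at h3
  · intro h C
    have : C.labelGraph false = G \ C.labelGraph true := by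
      ext x y
      simp only [SimpleGraph.EdgeLabeling.labelGraph_adj, SimpleGraph.sdiff_adj]
      grind
    rw [this]
    exact h _ C.labelGraph_le

namespace ArrowsStars

variable {G : SimpleGraph V} {n m s t : ℕ}

/-- Through this symmetry every lemma that removes a red star also removes a blue one. -/
theorem swap (h : ArrowsStars G n m s t) : ArrowsStars G m n t s := by
  intro R hR
  have := h (G \ R) sdiff_le
  rw [sdiff_sdiff_right_self, inf_eq_right.2 hR] at this
  exact this.symm

theorem iso {G' : SimpleGraph W} (h : ArrowsStars G n m s t) (e : G ≃g G') :
    ArrowsStars G' n m s t := by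
  intro R hR
  refine (h (R.comap e) fun a b hab => e.map_adj_iff.1 (hR hab)).imp ?_ ?_
  · exact fun h => h.map e.toEquiv.toEmbedding fun a b hab => hab
  · exact fun h => h.map e.toEquiv.toEmbedding fun a b hab =>
      ⟨e.map_adj_iff.2 hab.1, fun h => hab.2 h⟩

end ArrowsStars

/-! ### Removing vertices -/

/-- `G` with all edges that meet `U` removed. -/
def del (G : SimpleGraph V) (U : Set V) : SimpleGraph V where
  Adj a b := G.Adj a b ∧ a ∉ U ∧ b ∉ U
  symm := ⟨fun _ _ h => ⟨h.1.symm, h.2.2, h.2.1⟩⟩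
  loopless := ⟨fun a h => G.loopless.irrefl a h.1⟩

theorem ncard_edgeSet_del_singleton [Finite V] (G : SimpleGraph V) (v : V) :
    (del G {v}).edgeSet.ncard + (G.neighborSet v).ncard = G.edgeSet.ncard := by
  classical
  have h1 : del G {v} = G.deleteIncidenceSet v := by
    ext a b
    simp [del, SimpleGraph.deleteIncidenceSet_adj]
  have h2 : (G.neighborSet v).ncard = (G.incidenceSet v).ncard := by
    rw [← Nat.card_coe_set_eq, ← Nat.card_coe_set_eq]
    exact Nat.card_congr (G.incidenceSetEquivNeighborSet v).symm
  rw [h1, SimpleGraph.edgeSet_deleteIncidenceSet, h2]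
  exact Set.ncard_sdiff_add_ncard_of_subset (G.incidenceSet_subset v) (Set.toFinite _)

theorem ncard_edgeSet_le_of_le [Finite V] {G G' : SimpleGraph V} (h : G ≤ G') :
    G.edgeSet.ncard ≤ G'.edgeSet.ncard :=
  Set.ncard_le_ncard (SimpleGraph.edgeSet_mono h) (Set.toFinite _)

/-- The degree of `v` is taken after `u` is removed, so that a possible edge `uv` is counted once.
-/
theorem ncard_edgeSet_del_pair [Finite V] (G : SimpleGraph V) {U : Set V} {u v : V} (hu : u ∈ U)
    (hv : v ∈ U) : (del G U).edgeSet.ncard + ((del G {u}).neighborSet v).ncard +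
      (G.neighborSet u).ncard ≤ G.edgeSet.ncard := by
  have h1 := ncard_edgeSet_del_singleton G u
  have h2 := ncard_edgeSet_del_singleton (del G {u}) v
  have h3 : (del G U).edgeSet.ncard ≤ (del (del G {u}) {v}).edgeSet.ncard :=
    ncard_edgeSet_le_of_le fun a b h =>
      ⟨⟨h.1, fun h' => h.2.1 (h' ▸ hu), fun h' => h.2.2 (h' ▸ hu)⟩,
        fun h' => h.2.1 (h' ▸ hv), fun h' => h.2.2 (h' ▸ hv)⟩
  omega

/-- If the edges that meet `U` can be coloured so that the red stars that meet `U` pairwise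
intersect and no blue star meets `U`, then removing `U` costs at most one red star. -/
theorem ArrowsStars.del_set {G : SimpleGraph V} {n m s t : ℕ} (h : ArrowsStars G n m (s + 1) t)
    (U : Set V) (R₀ : SimpleGraph V) (hR₀ : R₀ ≤ G)
    (hred : ∀ R ≤ G, (∀ a b, a ∈ U → (R.Adj a b ↔ R₀.Adj a b)) → ∀ c L c' L', IsStar R n c L →
      IsStar R n c' L' → ¬ Disjoint (starVerts c L) U → ¬ Disjoint (starVerts c' L') U →
      ¬ Disjoint (starVerts c L) (starVerts c' L'))
    (hblue : ∀ R ≤ G, (∀ a b, a ∈ U → (R.Adj a b ↔ R₀.Adj a b)) → ∀ c L, IsStar (G \ R) m c L →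
      Disjoint (starVerts c L) U) :
    ArrowsStars (del G U) n m s t := by
  intro R' hR'
  -- The given colouring of `del G U` is extended by `R₀` on the edges that meet `U`.
  let R : SimpleGraph V :=
    { Adj := fun a b => (R₀.Adj a b ∧ (a ∈ U ∨ b ∈ U)) ∨ R'.Adj a b
      symm := ⟨fun a b h => h.imp (fun h => ⟨h.1.symm, h.2.symm⟩) fun h => h.symm⟩
      loopless := ⟨fun a h => h.elim (fun h => R₀.loopless.irrefl a h.1)
        fun h => R'.loopless.irrefl a h⟩ }
  have hR : R ≤ G := fun a b h => h.elim (fun h => hR₀ h.1) fun h => (hR' h).1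
  have hRU : ∀ a b, a ∈ U → (R.Adj a b ↔ R₀.Adj a b) := fun a b ha =>
    ⟨fun h => h.elim (fun h => h.1) fun h => absurd ha (hR' h).2.1, fun h => Or.inl ⟨h, Or.inl ha⟩⟩
  have hmem : ∀ {c : V} {L : Finset V} {l : V}, Disjoint (starVerts c L) U → l ∈ L →
      c ∉ U ∧ l ∉ U := fun hd hl =>
    ⟨Set.disjoint_left.1 hd (Set.mem_insert _ _),
      Set.disjoint_left.1 hd (Set.mem_insert_of_mem _ hl)⟩
  refine (h R hR).imp ?_ ?_
  · rintro ⟨c, L, h1, h2⟩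
    -- At most one of the disjoint red stars meets `U`. It is dropped; if there is none, an
    -- arbitrary one is dropped.
    obtain ⟨i₀, hi₀⟩ : ∃ i₀, ∀ i, i ≠ i₀ → Disjoint (starVerts (c i) (L i)) U := by
      by_cases hall : ∀ i, Disjoint (starVerts (c i) (L i)) U
      · exact ⟨0, fun i _ => hall i⟩
      · push Not at hall
        obtain ⟨i₀, hi₀⟩ := hall
        refine ⟨i₀, fun i hi => ?_⟩
        by_contra hne
        exact hred R hR hRU _ _ _ _ (h1 i) (h1 i₀) hne hi₀ (h2 i i₀ hi)
    refine ⟨c ∘ i₀.succAbove, L ∘ i₀.succAbove, fun i => ⟨(h1 _).card, fun l hl => ?_⟩,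
      fun i j hij => h2 _ _ (Fin.succAbove_right_injective.ne hij)⟩
    have := hmem (hi₀ _ (Fin.succAbove_ne i₀ i)) hl
    exact ((h1 _).adj l hl).resolve_left fun h => h.2.elim this.1 this.2
  · rintro ⟨c, L, h1, h2⟩
    refine ⟨c, L, fun i => ⟨(h1 i).card, fun l hl => ?_⟩, h2⟩
    have := hmem (hblue R hR hRU _ _ (h1 i)) hl
    have hadj := (h1 i).adj l hl
    exact ⟨⟨hadj.1, this⟩, fun h => hadj.2 (Or.inr h)⟩

theorem IsStar.exists_adj {R : SimpleGraph V} {n : ℕ} {c : V} {L : Finset V} (h : IsStar R n c L)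
    (hn : 0 < n) {v : V} (hv : v ∈ starVerts c L) : ∃ w, R.Adj v w := by
  rcases hv with rfl | hv
  · obtain ⟨l, hl⟩ := Finset.card_pos.1 (h.card ▸ hn)
    exact ⟨l, h.adj l hl⟩
  · exact ⟨c, (h.adj v hv).symm⟩

theorem IsStar.subset {R : SimpleGraph V} {n : ℕ} {c : V} {L : Finset V} (h : IsStar R n c L)
    {U : Set V} (hU : ∀ a b, a ∈ U → R.Adj a b → b ∈ U) (hm : ¬ Disjoint (starVerts c L) U) :
    starVerts c L ⊆ U := by
  obtain ⟨v, hv, hvU⟩ := Set.not_disjoint_iff.1 hm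
  have hc : c ∈ U := by
    rcases hv with rfl | hv
    · exact hvU
    · exact hU v c hvU (h.adj v hv).symm
  rintro w (rfl | hw)
  · exact hc
  · exact hU c w hc (h.adj w hw)

theorem IsStar.ncard_starVerts {R : SimpleGraph V} {n : ℕ} {c : V} {L : Finset V}
    (h : IsStar R n c L) : (starVerts c L).ncard = n + 1 := by
  rw [starVerts, Set.ncard_insert_of_notMem fun hc => (h.adj c hc).ne rfl, Set.ncard_coe_finset,
    h.card]

namespace ArrowsStars

variable {G : SimpleGraph V} {n m s t : ℕ}

/-- All edges at `v` are coloured red: the red stars that meet `{v}` share `v`, and no blue edge is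
left there. -/
theorem del_vertex (h : ArrowsStars G n m (s + 1) t) (hm : 0 < m) (v : V) :
    ArrowsStars (del G {v}) n m s t := by
  refine h.del_set {v} G le_rfl ?_ ?_
  · intro R _ _ c L c' L' _ _ h1 h2 h3
    rw [Set.disjoint_singleton_right, not_not] at h1 h2
    exact Set.disjoint_left.1 h3 h1 h2
  · intro R hR hRU c L hL
    rw [Set.disjoint_singleton_right]
    intro hv
    obtain ⟨w, hw⟩ := hL.exists_adj hm hv
    exact hw.2 ((hRU v w rfl).2 hw.1)

theorem del_vertex' (h : ArrowsStars G n m s (t + 1)) (hn : 0 < n) (v : V) :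
    ArrowsStars (del G {v}) n m s t :=
  (h.swap.del_vertex hn v).swap

/-- A union of components that is too small for two disjoint red stars can be removed at the cost of
one red star. -/
theorem del_small [Finite V] (h : ArrowsStars G n m (s + 1) t) (hm : 0 < m) {U : Set V}
    (hU : ∀ a b, a ∈ U → G.Adj a b → b ∈ U) (hcard : U.ncard < 2 * (n + 1)) :
    ArrowsStars (del G U) n m s t := by
  refine h.del_set U G le_rfl ?_ ?_
  · intro R hR _ c L c' L' hL hL' h1 h2 h3
    have hUR : ∀ a b, a ∈ U → R.Adj a b → b ∈ U := fun a b ha hab => hU a b ha (hR hab)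
    have := Set.ncard_le_ncard (Set.union_subset (hL.subset hUR h1) (hL'.subset hUR h2))
      (Set.toFinite _)
    rw [Set.ncard_union_eq h3 (Set.toFinite _) (Set.toFinite _), hL.ncard_starVerts,
      hL'.ncard_starVerts] at this
    omega
  · intro R hR hRU c L hL
    rw [Set.disjoint_left]
    intro v hv hvU
    obtain ⟨w, hw⟩ := hL.exists_adj hm hv
    exact hw.2 ((hRU v w hvU).2 hw.1)

/-- A pair of vertices of degree `n + m - 1` with a common neighbour, whose neighbours have no
further neighbours, can be removed at the cost of one red star. -/
theorem del_pair [Finite V] (h : ArrowsStars G n m (s + 1) t) (hn : 0 < n) (hm : 0 < m) {u v w : V}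
    (huv : u ≠ v) (hnadj : ¬ G.Adj u v) (hu : (G.neighborSet u).ncard = n + m - 1)
    (hv : (G.neighborSet v).ncard = n + m - 1) (huw : G.Adj u w) (hvw : G.Adj v w)
    (hnb : ∀ a b, (G.Adj u a ∨ G.Adj v a) → G.Adj a b → b = u ∨ b = v)
    (hne : ¬ (n = 1 ∧ m = 2 ∧ G.neighborSet u = G.neighborSet v)) :
    ArrowsStars (del G ({u, v} ∪ G.neighborSet u ∪ G.neighborSet v)) n m s t := by
  classical
  -- The red edges will join `u` to `A` and `v` to `B`, which leaves `m - 1` blue edges at each. The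
  -- common vertex `w` makes red stars meet; for `m = 2`, covering the common neighbours prevents a
  -- blue star with leaves `u` and `v`.
  obtain ⟨A, B, hA, hB, hAc, hBc, hwA, hwB, hAB⟩ : ∃ A B : Set V, A ⊆ G.neighborSet u ∧
      B ⊆ G.neighborSet v ∧ A.ncard = n ∧ B.ncard = n ∧ w ∈ A ∧ w ∈ B ∧
      (m = 2 → ∀ x, G.Adj u x → G.Adj v x → x ∈ A ∨ x ∈ B) := by
    by_cases hm2 : m = 2
    · have hcu : (G.neighborSet u \ {w}).ncard = n := by
        rw [Set.ncard_sdiff_singleton_of_mem (show w ∈ G.neighborSet u from huw), hu]; omega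
      have hcv : (G.neighborSet v \ {w}).ncard = n := by
        rw [Set.ncard_sdiff_singleton_of_mem (show w ∈ G.neighborSet v from hvw), hv]; omega
      -- For `m = 2` each of `A`, `B` omits one neighbour. The omitted vertices can be distinct and
      -- different from `w` unless both neighbourhoods are the same pair, the case excluded by
      -- `hne`.
      obtain ⟨x, hx, y, hy, hxy⟩ : ∃ x ∈ G.neighborSet u \ {w}, ∃ y ∈ G.neighborSet v \ {w},
          x ≠ y := by
        by_contra! hall
        obtain ⟨x, hx⟩ := (Set.ncard_pos (Set.toFinite _)).1 (hcu ▸ hn)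
        obtain ⟨y, hy⟩ := (Set.ncard_pos (Set.toFinite _)).1 (hcv ▸ hn)
        have hux : G.neighborSet u \ {w} = {x} := Set.eq_singleton_iff_unique_mem.2
          ⟨hx, fun z hz => (hall z hz y hy).trans (hall x hx y hy).symm⟩
        have hvx : G.neighborSet v \ {w} = {x} := Set.eq_singleton_iff_unique_mem.2
          ⟨hall x hx y hy ▸ hy, fun z hz => (hall x hx z hz).symm⟩
        refine hne ⟨by rw [← hcu, hux, Set.ncard_singleton], hm2, ?_⟩
        have h1 := Set.insert_sdiff_self_of_mem (show w ∈ G.neighborSet u from huw)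
        have h2 := Set.insert_sdiff_self_of_mem (show w ∈ G.neighborSet v from hvw)
        rw [← h1, ← h2, hux, hvx]
      refine ⟨G.neighborSet u \ {x}, G.neighborSet v \ {y}, Set.sdiff_subset, Set.sdiff_subset,
        ?_, ?_, ⟨huw, fun h => hx.2 h.symm⟩, ⟨hvw, fun h => hy.2 h.symm⟩, ?_⟩
      · rw [Set.ncard_sdiff_singleton_of_mem hx.1, hu]; omega
      · rw [Set.ncard_sdiff_singleton_of_mem hy.1, hv]; omega
      · intro _ z hz1 hz2
        by_cases hzx : z = x
        · exact Or.inr ⟨hz2, fun h => hxy (hzx.symm.trans h)⟩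
        · exact Or.inl ⟨hz1, hzx⟩
    · obtain ⟨A, hA1, hA2, hA3⟩ := Set.exists_subsuperset_card_eq
        (Set.singleton_subset_iff.2 (show w ∈ G.neighborSet u from huw))
        (show ({w} : Set V).ncard ≤ n by rw [Set.ncard_singleton]; exact hn) (by rw [hu]; omega)
      obtain ⟨B, hB1, hB2, hB3⟩ := Set.exists_subsuperset_card_eq
        (Set.singleton_subset_iff.2 (show w ∈ G.neighborSet v from hvw))
        (show ({w} : Set V).ncard ≤ n by rw [Set.ncard_singleton]; exact hn) (by rw [hv]; omega)
      exact ⟨A, B, hA2, hB2, hA3, hB3, hA1 rfl, hB1 rfl, fun h => absurd h hm2⟩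
  set U : Set V := {u, v} ∪ G.neighborSet u ∪ G.neighborSet v with hUdef
  have hUc : ∀ a b, a ∈ U → G.Adj a b → b ∈ U := by
    rintro a b (((rfl | rfl) | ha) | ha) hab
    · exact Or.inl (Or.inr hab)
    · exact Or.inr hab
    · rcases hnb a b (Or.inl ha) hab with rfl | rfl <;> simp [U]
    · rcases hnb a b (Or.inr ha) hab with rfl | rfl <;> simp [U]
  let R₀ : SimpleGraph V :=
    { Adj := fun a b => (a = u ∧ b ∈ A) ∨ (b = u ∧ a ∈ A) ∨ (a = v ∧ b ∈ B) ∨ (b = v ∧ a ∈ B)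
      symm := ⟨fun a b h => by tauto⟩
      loopless := ⟨fun a h => by
        have h1 : u ∉ A := fun h => G.loopless.irrefl u (hA h)
        have h2 : v ∉ B := fun h => G.loopless.irrefl v (hB h)
        rcases h with ⟨rfl, h⟩ | ⟨rfl, h⟩ | ⟨rfl, h⟩ | ⟨rfl, h⟩ <;> contradiction⟩ }
  have huB : u ∉ B := fun h => hnadj (G.symm.symm _ _ (hB h))
  have hvA : v ∉ A := fun h => hnadj (hA h)
  have hR₀u : ∀ b, R₀.Adj u b ↔ b ∈ A := fun b =>
    ⟨by rintro (h | ⟨rfl, h⟩ | ⟨h, -⟩ | ⟨-, h⟩); exacts [h.2, absurd (hA h) (G.loopless.irrefl _),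
      absurd h huv, absurd h huB], fun h => Or.inl ⟨rfl, h⟩⟩
  have hR₀v : ∀ b, R₀.Adj v b ↔ b ∈ B := fun b =>
    ⟨by rintro (⟨h, -⟩ | ⟨-, h⟩ | h | ⟨rfl, h⟩); exacts [absurd h.symm huv, absurd h hvA, h.2,
      absurd (hB h) (G.loopless.irrefl _)], fun h => Or.inr (Or.inr (Or.inl ⟨rfl, h⟩))⟩
  have hR₀ : R₀ ≤ G := by
    rintro a b (⟨rfl, h⟩ | ⟨rfl, h⟩ | ⟨rfl, h⟩ | ⟨rfl, h⟩)
    exacts [hA h, G.symm.symm _ _ (hA h), hB h, G.symm.symm _ _ (hB h)]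
  have huU : u ∈ U := by simp [U]
  have hvU : v ∈ U := by simp [U]
  have hcases : ∀ a ∈ U, a = u ∨ a = v ∨ ∀ b, G.Adj a b → b = u ∨ b = v := by
    rintro a (((rfl | rfl) | ha) | ha)
    exacts [Or.inl rfl, Or.inr (Or.inl rfl), Or.inr (Or.inr fun b => hnb a b (Or.inl ha)),
      Or.inr (Or.inr fun b => hnb a b (Or.inr ha))]
  have hpair : ∀ {L : Finset V}, (∀ l ∈ L, l = u ∨ l = v) → L ⊆ {u, v} := fun hL l hl => by
    simpa using hL l hl
  refine h.del_set U R₀ hR₀ ?_ ?_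
  · intro R hR hRU
    -- A red star that meets `U` contains two of the three vertices `u`, `v`, `w`, so any two of
    -- them intersect.
    have key : ∀ c L, IsStar R n c L → ¬ Disjoint (starVerts c L) U →
        (w ∈ starVerts c L ∧ (u ∈ starVerts c L ∨ v ∈ starVerts c L)) ∨
          (u ∈ starVerts c L ∧ v ∈ starVerts c L) := by
      intro c L hL hm'
      have hcU : c ∈ U :=
        hL.subset (fun a b ha hab => hUc a b ha (hR hab)) hm' (Set.mem_insert _ _)
      have hfull : ∀ (S : Set V), S.ncard = n → (∀ l ∈ L, l ∈ S) → w ∈ S → w ∈ L := by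
        intro S hS hLS hw
        have : (L : Set V) = S := Set.eq_of_subset_of_ncard_le hLS
          (by rw [hS, Set.ncard_coe_finset, hL.card]) (Set.toFinite _)
        rw [← Finset.mem_coe, this]
        exact hw
      rcases hcases c hcU with rfl | rfl | hc
      · exact Or.inl ⟨Or.inr (hfull A hAc (fun l hl => (hR₀u l).1 ((hRU _ _ huU).1 (hL.adj l hl)))
          hwA), Or.inl (Or.inl rfl)⟩
      · exact Or.inl ⟨Or.inr (hfull B hBc (fun l hl => (hR₀v l).1 ((hRU _ _ hvU).1 (hL.adj l hl)))
          hwB), Or.inr (Or.inl rfl)⟩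
      · have hsub : ∀ l ∈ L, l = u ∨ l = v := fun l hl => hc l (hR (hL.adj l hl))
        by_cases h2 : u ∈ L ∧ v ∈ L
        · exact Or.inr ⟨Or.inr h2.1, Or.inr h2.2⟩
        · have hn1 : n = 1 := by
            have : L.card ≤ 1 := Finset.card_le_one.2 fun a ha b hb => by
              rcases hsub a ha with rfl | rfl <;> rcases hsub b hb with rfl | rfl <;> tauto
            have := hL.card
            omega
          obtain ⟨l, hl⟩ := Finset.card_pos.1 (hL.card ▸ hn)
          have hRl := (hRU c l hcU).1 (hL.adj l hl)
          rcases hsub l hl with rfl | rfl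
          · have hcA : c ∈ A := (hR₀u c).1 hRl.symm
            have : c = w := (Set.ncard_le_one (Set.toFinite _)).1 (by omega) c hcA w hwA
            exact Or.inl ⟨Or.inl this.symm, Or.inl (Or.inr hl)⟩
          · have hcB : c ∈ B := (hR₀v c).1 hRl.symm
            have : c = w := (Set.ncard_le_one (Set.toFinite _)).1 (by omega) c hcB w hwB
            exact Or.inl ⟨Or.inl this.symm, Or.inr (Or.inr hl)⟩
    intro c L c' L' hL hL' hm1 hm2
    rw [Set.not_disjoint_iff]
    rcases key c L hL hm1 with ⟨h1, h1'⟩ | ⟨h1, h1'⟩ <;>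
      rcases key c' L' hL' hm2 with ⟨h2, h2'⟩ | ⟨h2, h2'⟩
    · exact ⟨w, h1, h2⟩
    · rcases h1' with h1' | h1'
      exacts [⟨u, h1', h2⟩, ⟨v, h1', h2'⟩]
    · rcases h2' with h2' | h2'
      exacts [⟨u, h1, h2'⟩, ⟨v, h1', h2'⟩]
    · exact ⟨u, h1, h2⟩
  · intro R hR hRU c L hL
    by_contra hm'
    have hcU : c ∈ U := hL.subset (fun a b ha hab => hUc a b ha hab.1) hm' (Set.mem_insert _ _)
    have hless : ∀ (S N : Set V), S ⊆ N → S.ncard = n → N.ncard = n + m - 1 →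
        (∀ l ∈ L, l ∈ N \ S) → False := by
      intro S N hSN hS hN hLS
      have h1 := Set.ncard_le_ncard (show (L : Set V) ⊆ N \ S from hLS) (Set.toFinite _)
      rw [Set.ncard_coe_finset, hL.card, Set.ncard_sdiff hSN (Set.toFinite _), hS, hN] at h1
      omega
    rcases hcases c hcU with rfl | rfl | hc
    · exact hless A _ hA hAc hu fun l hl => ⟨(hL.adj l hl).1, fun hlA =>
        (hL.adj l hl).2 ((hRU _ _ huU).2 ((hR₀u l).2 hlA))⟩
    · exact hless B _ hB hBc hv fun l hl => ⟨(hL.adj l hl).1, fun hlB =>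
        (hL.adj l hl).2 ((hRU _ _ hvU).2 ((hR₀v l).2 hlB))⟩
    · have hsub : ∀ l ∈ L, l = u ∨ l = v := fun l hl => hc l (hL.adj l hl).1
      by_cases h2 : u ∈ L ∧ v ∈ L
      · have hm2 : m = 2 := by
          have h1 : L = {u, v} := Finset.Subset.antisymm (hpair hsub)
            (by simp [Finset.insert_subset_iff, h2])
          rw [← hL.card, h1, Finset.card_pair huv]
        rcases hAB hm2 c (hL.adj u h2.1).1.symm (hL.adj v h2.2).1.symm with hc' | hc'
        · exact (hL.adj u h2.1).2 ((hRU _ _ hcU).2 ((hR₀u c).2 hc').symm)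
        · exact (hL.adj v h2.2).2 ((hRU _ _ hcU).2 ((hR₀v c).2 hc').symm)
      -- For `m = 1` the sets `A` and `B` are the whole neighbourhoods, so no blue edge meets `U`.
      · have hm1 : m = 1 := by
          have : L.card ≤ 1 := Finset.card_le_one.2 fun a ha b hb => by
            rcases hsub a ha with rfl | rfl <;> rcases hsub b hb with rfl | rfl <;> tauto
          have := hL.card
          omega
        have hAu : A = G.neighborSet u :=
          Set.eq_of_subset_of_ncard_le hA (by omega) (Set.toFinite _)
        have hBv : B = G.neighborSet v :=
          Set.eq_of_subset_of_ncard_le hB (by omega) (Set.toFinite _)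
        obtain ⟨l, hl⟩ := Finset.card_pos.1 (hL.card ▸ hm)
        have hadj := hL.adj l hl
        rcases hsub l hl with rfl | rfl
        · exact hadj.2 ((hRU _ _ hcU).2 ((hR₀u c).2 (hAu ▸ hadj.1.symm)).symm)
        · exact hadj.2 ((hRU _ _ hcU).2 ((hR₀v c).2 (hBv ▸ hadj.1.symm)).symm)

end ArrowsStars

end Stars
/-! ### Graphs of small maximum degree -/

section LowDegree

variable {V K : Type*}

/-- The vertices `x`, `y`, `z` span a component that is a triangle. -/
def TriangleAt (G : SimpleGraph V) (x y z : V) : Prop :=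
  G.neighborSet x = {y, z} ∧ G.neighborSet y = {x, z} ∧ G.neighborSet z = {x, y}

/-- The `n` edges of the star have distinct colours in a set of `n` colours, so they use all of
them. -/
theorem IsStar.exists_color {R : SimpleGraph V} {n : ℕ} {u : V} {L : Finset V}
    (h : IsStar R n u L) (c : PartialEdgeColoring V K) {Q : Finset K} (hQ : Q.card = n)
    (hR : ∀ v, R.Adj u v → ∃ a ∈ Q, c.color u v = some a) {a : K} (ha : a ∈ Q) :
    ∃ l ∈ L, c.color u l = some a := by
  classical
  have : Nonempty K := ⟨a⟩
  choose! f hfQ hf using hR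
  have hinj : Set.InjOn f L := fun x hx y hy hxy =>
    c.proper u x y (f x) (hf x (h.adj x hx)) (hxy ▸ hf y (h.adj y hy))
  have himg : L.image f = Q := Finset.eq_of_subset_of_card_le
    (fun b hb => by
      obtain ⟨l, hl, rfl⟩ := Finset.mem_image.1 hb
      exact hfQ l (h.adj l hl))
    (by rw [Finset.card_image_of_injOn hinj, h.card, hQ])
  rw [← himg] at ha
  obtain ⟨l, hl, rfl⟩ := Finset.mem_image.1 ha
  exact ⟨l, hl, hf l (h.adj l hl)⟩

/-- An edge of `M` chosen by two of the stars would give them a common vertex, so disjoint stars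
choose distinct edges. -/
theorem HasStars.le_card {R : SimpleGraph V} {n s : ℕ} (h : HasStars R n (Fin s))
    (M : Finset (Sym2 V)) (hM : ∀ c L, IsStar R n c L → ∃ l ∈ L, s(c, l) ∈ M) : s ≤ M.card := by
  obtain ⟨c, L, h1, h2⟩ := h
  choose f hfL hfM using fun i => hM _ _ (h1 i)
  have hinj : Function.Injective fun i : Fin s => (⟨s(c i, f i), hfM i⟩ : M) := by
    intro i j hij
    by_contra hne
    have hij' : s(c i, f i) = s(c j, f j) := congrArg Subtype.val hij
    have hmem : c i ∈ s(c j, f j) := hij' ▸ Sym2.mem_mk_left _ _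
    refine Set.disjoint_left.1 (h2 i j hne) (Or.inl rfl) ?_
    rcases Sym2.mem_iff.1 hmem with h | h
    · exact h ▸ Or.inl rfl
    · exact h ▸ Or.inr (hfL j)
  simpa using Fintype.card_le_of_injective _ hinj

/-- Colouring the edges of a properly edge-coloured graph by grouping the colours: `P` is the set of
red colours, and the edges of colour `a₀` are distributed. -/
theorem not_arrowsStars_of_coloring [Fintype K] [DecidableEq K] {G : SimpleGraph V} {n m s t : ℕ}
    (c : PartialEdgeColoring V K) (hc : ∀ u v, c.color u v ≠ none ↔ G.Adj u v) (a₀ : K)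
    (P : Finset K) (ha₀ : a₀ ∉ P) (hP : P.card + 1 = n) (hPc : Pᶜ.card = m)
    (A B : Finset (Sym2 V)) (hA : A.card < s) (hB : B.card < t)
    (hAB : ∀ u v, c.color u v = some a₀ → s(u, v) ∈ A ∨ s(u, v) ∈ B ∨ ∃ x ∈ P, c.Missing u x) :
    ¬ ArrowsStars G n m s t := by
  intro h
  -- A red star uses all `n` colours of `P` and `a₀`: its centre misses no colour of `P`, and its
  -- edge of colour `a₀` lies in `A`. A blue star uses all `m` colours outside `P`, and its edge of
  -- colour `a₀` lies in `B`.
  let R : SimpleGraph V :=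
    { Adj := fun u v => ∃ a, c.color u v = some a ∧ (a ∈ P ∨ (a = a₀ ∧ s(u, v) ∉ B))
      symm := ⟨fun u v h => by rwa [c.symm v u, Sym2.eq_swap]⟩
      loopless := ⟨fun u h => by simp [c.irrefl u] at h⟩ }
  have hR : R ≤ G := fun u v ⟨a, ha, _⟩ => (hc u v).1 (by simp [ha])
  rcases h R hR with h | h
  · refine (h.le_card A fun u L hL => ?_).not_gt hA
    have hcol := fun a => hL.exists_color c (Q := insert a₀ P) (a := a)
      (by rw [Finset.card_insert_of_notMem ha₀, hP]) (by
        rintro v ⟨a, ha, h | ⟨rfl, -⟩⟩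
        · exact ⟨a, Finset.mem_insert_of_mem h, ha⟩
        · exact ⟨a, Finset.mem_insert_self _ _, ha⟩)
    obtain ⟨l, hl, hla⟩ := hcol a₀ (Finset.mem_insert_self _ _)
    refine ⟨l, hl, ?_⟩
    obtain ⟨a, ha, hR'⟩ := hL.adj l hl
    rw [hla, Option.some.injEq] at ha
    subst ha
    rcases hAB u l hla with h | h | ⟨x, hx, hmis⟩
    · exact h
    · exact absurd h (hR'.resolve_left ha₀).2
    · obtain ⟨l', -, hl'⟩ := hcol x (Finset.mem_insert_of_mem hx)
      exact absurd hl' (hmis l')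
  · refine (h.le_card B fun u L hL => ?_).not_gt hB
    obtain ⟨l, hl, hla⟩ := hL.exists_color c (Q := Pᶜ) (a := a₀) hPc (by
        rintro v ⟨hG, hnR⟩
        obtain ⟨a, ha⟩ := Option.ne_none_iff_exists'.1 ((hc u v).2 hG)
        exact ⟨a, Finset.mem_compl.2 fun haP => hnR ⟨a, ha, Or.inl haP⟩, ha⟩)
      (Finset.mem_compl.2 ha₀)
    refine ⟨l, hl, ?_⟩
    by_contra hlB
    exact (hL.adj l hl).2 ⟨a₀, hla, Or.inr ⟨rfl, hlB⟩⟩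

open Classical in
/-- The edges of a given colour. -/
noncomputable def PartialEdgeColoring.colorClass [Finite V] (c : PartialEdgeColoring V K) (a : K) :
    Finset (Sym2 V) :=
  (Set.toFinite {e | Sym2.lift ⟨c.color, c.symm⟩ e = some a}).toFinset

theorem PartialEdgeColoring.mem_colorClass [Finite V] (c : PartialEdgeColoring V K) (a : K)
    (u v : V) : s(u, v) ∈ c.colorClass a ↔ c.color u v = some a := by
  simp [colorClass]

theorem PartialEdgeColoring.sum_card_colorClass [Finite V] [Fintype K] {G : SimpleGraph V}
    (c : PartialEdgeColoring V K) (hc : ∀ u v, c.color u v ≠ none ↔ G.Adj u v) :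
    ∑ a, (c.colorClass a).card = G.edgeSet.ncard := by
  classical
  rw [← Finset.card_biUnion, ← Set.ncard_coe_finset]
  · congr 1
    ext e
    induction e using Sym2.inductionOn with
    | _ u v =>
    simp only [Finset.coe_biUnion, Finset.coe_univ, Set.mem_univ, Set.iUnion_true, Set.mem_iUnion,
      Finset.mem_coe, c.mem_colorClass, SimpleGraph.mem_edgeSet, ← hc]
    exact Option.ne_none_iff_exists'.symm
  · intro a _ b _ hab
    rw [Function.onFun, Finset.disjoint_left]
    intro e
    induction e using Sym2.inductionOn with
    | _ u v =>
    rw [c.mem_colorClass, c.mem_colorClass]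
    intro h1 h2
    exact hab (Option.some.inj (h1.symm.trans h2))

theorem exists_finset_split {α : Type*} [DecidableEq α] {s t : ℕ} (hs : 0 < s) (ht : 0 < t)
    (M : Finset α) (hM : M.card < s + t - 1) :
    ∃ A B : Finset α, A.card < s ∧ B.card < t ∧ ∀ e ∈ M, e ∈ A ∨ e ∈ B := by
  obtain ⟨A, hAM, hA⟩ := Finset.exists_subset_card_eq (min_le_right (s - 1) M.card)
  refine ⟨A, M \ A, by omega, ?_, fun e he => ?_⟩
  · rw [Finset.card_sdiff_of_subset hAM]
    omega
  · by_cases h : e ∈ A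
    · exact Or.inl h
    · exact Or.inr (Finset.mem_sdiff.2 ⟨he, h⟩)

/-- The colour classes of a proper colouring of an arrowing graph cannot be small, nor contain an
edge whose ends miss colours that fit among the red colours. -/
theorem ArrowsStars.card_colorClass [Finite V] {G : SimpleGraph V} {n m s t : ℕ} (hs : 0 < s)
    (ht : 0 < t) (hn : 0 < n) (hm : 0 < m) (h : ArrowsStars G n m s t)
    (c : PartialEdgeColoring V (Fin (n + m - 1))) (hc : ∀ u v, c.color u v ≠ none ↔ G.Adj u v)
    (a : Fin (n + m - 1)) :
    s + t - 1 ≤ (c.colorClass a).card ∧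
      ((c.colorClass a).card = s + t - 1 → ∀ u v x y, c.color u v = some a → c.Missing u x →
        c.Missing v y → ¬ (x = y ∧ 2 ≤ n ∨ 3 ≤ n)) := by
  classical
  -- The colours in `Q` are made red. An edge of colour `a` outside `M` misses a colour of `Q` at
  -- each end, so it lies in no red star and can be red for free.
  have hsplit : ∀ Q : Finset (Fin (n + m - 1)), a ∉ Q → Q.card < n → ∀ M : Finset (Sym2 V),
      M.card < s + t - 1 → (∀ u v, c.color u v = some a → s(u, v) ∈ M ∨ ∃ x ∈ Q, c.Missing u x) →
      False := by
    intro Q haQ hQ M hM hQM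
    obtain ⟨P, hQP, hPa, hP⟩ := Finset.exists_subsuperset_card_eq
      (show Q ⊆ {a}ᶜ from fun x hx => by
        rw [Finset.mem_compl, Finset.mem_singleton]; rintro rfl; exact haQ hx)
      (show Q.card ≤ n - 1 by omega)
      (by rw [Finset.card_compl, Finset.card_singleton, Fintype.card_fin]; omega)
    obtain ⟨A, B, hA, hB, hAB⟩ := exists_finset_split hs ht M hM
    refine not_arrowsStars_of_coloring c hc a P
      (fun h => by simpa using hPa h) (by omega)
      (by rw [Finset.card_compl, hP, Fintype.card_fin]; omega) A B hA hB (fun u v huv => ?_) h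
    rcases hQM u v huv with h | ⟨x, hx, hx'⟩
    · exact (hAB _ h).imp id Or.inl
    · exact Or.inr (Or.inr ⟨x, hQP hx, hx'⟩)
  refine ⟨?_, fun hcard u v x y huv hx hy hxy => ?_⟩
  · by_contra hlt
    exact hsplit ∅ (by simp) (by simpa using hn) (c.colorClass a) (by omega)
      fun u v huv => Or.inl ((c.mem_colorClass a u v).2 huv)
  -- The edge `uv` is free, which leaves only `s + t - 2` edges of colour `a` to distribute.
  · refine hsplit {x, y} ?_ ?_ ((c.colorClass a).erase s(u, v)) ?_ ?_
    · rw [Finset.mem_insert, Finset.mem_singleton]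
      rintro (rfl | rfl)
      · exact hx v huv
      · exact hy u (by rw [c.symm v u, huv])
    · rcases hxy with ⟨rfl, h⟩ | h
      · rw [Finset.pair_eq_singleton, Finset.card_singleton]; omega
      · exact lt_of_le_of_lt Finset.card_le_two h
    · rw [Finset.card_erase_of_mem ((c.mem_colorClass a u v).2 huv)]
      omega
    · intro u' v' h'
      by_cases he : s(u', v') = s(u, v)
      · refine Or.inr ?_
        rcases Sym2.eq_iff.1 he with ⟨rfl, rfl⟩ | ⟨rfl, rfl⟩
        · exact ⟨x, by simp, hx⟩
        · exact ⟨y, by simp, hy⟩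
      · exact Or.inl (Finset.mem_erase.2 ⟨he, (c.mem_colorClass a u' v').2 h'⟩)

theorem PartialEdgeColoring.exists_missing_of_degree_lt [Finite V] {N : ℕ} {G : SimpleGraph V}
    (hG : ∀ v, (G.neighborSet v).ncard < N) (c : PartialEdgeColoring V (Fin N))
    (hc : ∀ u v, c.color u v ≠ none ↔ G.Adj u v) (v : V) : ∃ a, c.Missing v a :=
  c.exists_missing v (by
    rw [Nat.card_eq_fintype_card, Fintype.card_fin]
    convert hG v using 2
    ext w
    exact hc v w)

open Classical in
/-- Exchange the colours `a` and `b` of two adjacent edges `uv` and `uw`. -/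
theorem PartialEdgeColoring.exists_exchange (c : PartialEdgeColoring V K) {u v w : V} {a b : K}
    (hv : c.color u v = some a) (hw : c.color u w = some b) (hvb : c.Missing v b)
    (hwa : c.Missing w a) : ∃ c' : PartialEdgeColoring V K, ∀ x y, c'.color x y =
      if (x = u ∧ y = v) ∨ (x = v ∧ y = u) then some b else
        if (x = u ∧ y = w) ∨ (x = w ∧ y = u) then some a else c.color x y := by
  have huv : u ≠ v := fun h => by simp [h, c.irrefl] at hv
  have huw : u ≠ w := fun h => by simp [h, c.irrefl] at hw
  have hvw : v ≠ w := fun h => hvb u (by rw [c.symm, h, hw])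
  unfold Missing at hvb hwa
  refine ⟨⟨fun x y => if (x = u ∧ y = v) ∨ (x = v ∧ y = u) then some b else
        if (x = u ∧ y = w) ∨ (x = w ∧ y = u) then some a else c.color x y, ?_, ?_, ?_⟩,
        fun x y => rfl⟩
  · intro x y
    have := c.symm x y
    grind
  · intro x
    have := c.irrefl x
    grind
  · intro x y z d
    have := c.proper x y z d
    have := c.proper u y v a
    have := c.proper u z v a
    have := c.proper u y w b
    have := c.proper u z w b
    have := hvb y
    have := hvb z
    have := hwa y
    have := hwa z
    clear hvb hwa
    grind

/-- If in every proper colouring with three colours the ends of an edge miss different colours, then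
all components are triangles. -/
theorem exists_triangleAt [Finite V] {G : SimpleGraph V} (hG : ∀ v, (G.neighborSet v).ncard < 3)
    (c : PartialEdgeColoring V (Fin 3)) (hc : ∀ u v, c.color u v ≠ none ↔ G.Adj u v)
    (H : ∀ c : PartialEdgeColoring V (Fin 3), (∀ u v, c.color u v ≠ none ↔ G.Adj u v) →
      ∀ u v x, G.Adj u v → c.Missing u x → ¬ c.Missing v x)
    {u : V} (hu : ∃ v, G.Adj u v) : ∃ y z, TriangleAt G u y z := by
  obtain ⟨v, huv⟩ := hu
  have hmis := c.exists_missing_of_degree_lt hG hc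
  have third : ∀ {a b d e : Fin 3}, a ≠ b → a ≠ d → b ≠ d → e = a ∨ e = b ∨ e = d := by decide
  have hne : ∀ {x y a b}, c.color x y = some a → c.Missing x b → a ≠ b :=
    fun h h' hab => h' _ (hab ▸ h)
  have hex : ∀ {x a}, ¬ c.Missing x a → ∃ y, c.color x y = some a := fun h => by
    unfold PartialEdgeColoring.Missing at h
    push Not at h
    exact h
  have hadj : ∀ {x y a}, c.color x y = some a → G.Adj x y := fun h => (hc _ _).1 (by simp [h])
  obtain ⟨α, hα⟩ := Option.ne_none_iff_exists'.1 ((hc u v).2 huv)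
  have hα' : c.color v u = some α := by rw [c.symm v u, hα]
  obtain ⟨β, hβ⟩ := hmis u
  have hαβ : α ≠ β := hne hα hβ
  obtain ⟨w, hw⟩ := hex (H c hc u v β huv hβ)
  obtain ⟨γ, hγ⟩ := hmis v
  have hαγ : α ≠ γ := hne hα' hγ
  have hβγ : β ≠ γ := hne hw hγ
  obtain ⟨u', hu'⟩ := hex (H c hc v u γ huv.symm hγ)
  have hnb : ∀ {p q r a b d}, c.color p q = some a → c.color p r = some b → c.Missing p d →
      a ≠ b → G.neighborSet p = {q, r} := by
    intro p q r a b d h1 h2 h3 hab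
    ext x
    rw [SimpleGraph.mem_neighborSet, Set.mem_insert_iff, Set.mem_singleton_iff]
    constructor
    · intro hx
      obtain ⟨e, he⟩ := Option.ne_none_iff_exists'.1 ((hc p x).2 hx)
      rcases third hab (hne h1 h3) (hne h2 h3) (e := e) with rfl | rfl | rfl
      · exact Or.inl (c.proper p x q _ he h1)
      · exact Or.inr (c.proper p x r _ he h2)
      · exact absurd he (h3 x)
    · rintro (rfl | rfl)
      exacts [hadj h1, hadj h2]
  have hw' : c.color w v = some β := by rw [c.symm w v, hw]
  have hu'' : c.color u' u = some γ := by rw [c.symm u' u, hu']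
  have hmα : ∀ {x y z}, c.color x y = some β → c.color x z = some γ → c.Missing x α := by
    intro x y z hy hz
    obtain ⟨d, hd⟩ := hmis x
    rcases third hαβ hαγ hβγ (e := d) with rfl | rfl | rfl
    exacts [hd, absurd hy (hd y), absurd hz (hd z)]
  -- At this point `uv` has colour `α`, `vw` has colour `β`, which `u` misses, and `uu'` has colour
  -- `γ`, which `v` misses.
  by_cases huw : u' = w
  · subst huw
    refine ⟨v, u', hnb hα hu' hβ hαγ, hnb hα' hw hγ hαβ, hnb hu'' hw' (hmα hw' hu'') hβγ.symm⟩
  · exfalso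
    obtain ⟨p, hp⟩ := hex (H c hc u u' β (hadj hu') hβ)
    have hu'α : c.Missing u' α := hmα hp hu''
    obtain ⟨q, hq⟩ := hex (H c hc v w γ (hadj hw) hγ)
    have hwα : c.Missing w α := hmα hw' hq
    have hvu' : v ≠ u' := fun h => hαγ (by subst h; rw [hα, Option.some.injEq] at hu'; exact hu')
    have hwu : w ≠ u := fun h => hαβ (by subst h; rw [hα', Option.some.injEq] at hw; exact hw)
    -- Once `uv` has colour `γ` and `uu'` has colour `α`, both ends of `vw` miss `α`, against `H`.
    obtain ⟨c', hc'⟩ := c.exists_exchange hα hu' hγ hu'α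
    have hc'c : ∀ x y, c'.color x y ≠ none ↔ c.color x y ≠ none := by
      intro x y
      rw [hc']
      split_ifs with h1 h2
      · rcases h1 with ⟨rfl, rfl⟩ | ⟨rfl, rfl⟩ <;> simp [hα, hα']
      · rcases h2 with ⟨rfl, rfl⟩ | ⟨rfl, rfl⟩ <;> simp [hu', hu'']
      · rfl
    refine H c' (fun x y => (hc'c x y).trans (hc x y)) v w α (hadj hw) (fun x hx => ?_)
      (fun x hx => ?_)
    · rw [hc'] at hx
      split_ifs at hx with h1 h2
      · exact hαγ (Option.some.inj hx).symm
      · rcases h2 with ⟨h, -⟩ | ⟨h, -⟩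
        exacts [huv.ne h.symm, hvu' h]
      · exact h1 (Or.inr ⟨rfl, c.proper v x u α hx hα'⟩)
    · rw [hc'] at hx
      split_ifs at hx with h1 h2
      · exact hαγ (Option.some.inj hx).symm
      · rcases h2 with ⟨h, -⟩ | ⟨h, -⟩
        exacts [hwu h, huw h.symm]
      · exact hwα x hx

/-- An arrowing graph of small maximum degree has many edges. -/
theorem ArrowsStars.of_degree_lt [Finite V] {G : SimpleGraph V} {n m s t : ℕ} (hs : 0 < s)
    (ht : 0 < t) (hm : 0 < m) (hmn : m ≤ n) (h : ArrowsStars G n m s t)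
    (hG : ∀ v, (G.neighborSet v).ncard < n + m - 1) :
    (s + t - 1) * (n + m - 1) ≤ G.edgeSet.ncard ∧
      (G.edgeSet.ncard = (s + t - 1) * (n + m - 1) → n = 2 ∧ m = 2 ∧
        ∀ v, (∃ w, G.Adj v w) → ∃ y z, TriangleAt G v y z) := by
  -- For `m = 1` all degrees are below `n`, so colouring every edge red leaves no red star and no
  -- blue edge.
  have hm2 : 2 ≤ m := by
    by_contra hm1
    obtain rfl : m = 1 := by omega
    rcases h G le_rfl with ⟨c, L, h1, -⟩ | ⟨c, L, h1, -⟩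
    · have := Set.ncard_le_ncard (show (L ⟨0, hs⟩ : Set V) ⊆ G.neighborSet (c ⟨0, hs⟩) from
        fun l hl => (h1 _).adj l hl) (Set.toFinite _)
      rw [Set.ncard_coe_finset, (h1 _).card] at this
      have := hG (c ⟨0, hs⟩)
      omega
    · obtain ⟨l, hl⟩ := Finset.card_pos.1 ((h1 ⟨0, ht⟩).card ▸ hm)
      have := (h1 _).adj l hl
      exact this.2 this.1
  obtain ⟨c, hc⟩ := exists_edgeColoring_of_degree_lt (K := Fin (n + m - 1)) G (by simpa using hG)
  have hle : ∀ (c : PartialEdgeColoring V (Fin (n + m - 1))),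
      (∀ u v, c.color u v ≠ none ↔ G.Adj u v) → ∀ a, s + t - 1 ≤ (c.colorClass a).card :=
    fun c hc a => (h.card_colorClass hs ht (by omega) hm c hc a).1
  have hsum : ∑ _a : Fin (n + m - 1), (s + t - 1) = (s + t - 1) * (n + m - 1) := by
    rw [Finset.sum_const, Finset.card_univ, Fintype.card_fin, smul_eq_mul, mul_comm]
  refine ⟨?_, fun heq => ?_⟩
  · rw [← hsum, ← c.sum_card_colorClass hc]
    exact Finset.sum_le_sum fun a _ => hle c hc a
  · have hcard : ∀ (c : PartialEdgeColoring V (Fin (n + m - 1))),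
        (∀ u v, c.color u v ≠ none ↔ G.Adj u v) → ∀ a, (c.colorClass a).card = s + t - 1 := by
      intro c hc a
      rw [← hsum, ← c.sum_card_colorClass hc] at heq
      exact ((Finset.sum_eq_sum_iff_of_le fun a _ => hle c hc a).1 heq.symm a (Finset.mem_univ a)).symm
    have H : ∀ (c : PartialEdgeColoring V (Fin (n + m - 1))),
        (∀ u v, c.color u v ≠ none ↔ G.Adj u v) → ∀ u v x y, G.Adj u v → c.Missing u x →
          c.Missing v y → ¬ (x = y ∧ 2 ≤ n ∨ 3 ≤ n) := by
      intro c hc u v x y huv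
      obtain ⟨a, ha⟩ := Option.ne_none_iff_exists'.1 ((hc u v).2 huv)
      exact (h.card_colorClass hs ht (by omega) hm c hc a).2 (hcard c hc a) u v x y ha
    -- Degrees are below the number of colours, so both ends of an edge miss a colour; for `n ≥ 3`
    -- two such colours fit among the `n - 1` red ones.
    have hn2 : n = 2 := by
      by_contra hn
      have hpos : 0 < G.edgeSet.ncard := by
        rw [heq]
        exact Nat.mul_pos (by omega) (by omega)
      obtain ⟨e, he⟩ := (Set.ncard_pos (Set.toFinite _)).1 hpos
      induction e using Sym2.inductionOn with
      | _ u v =>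
      obtain ⟨x, hx⟩ := c.exists_missing_of_degree_lt hG hc u
      obtain ⟨y, hy⟩ := c.exists_missing_of_degree_lt hG hc v
      exact H c hc u v x y he hx hy (Or.inr (by omega))
    obtain rfl : m = 2 := by omega
    subst hn2
    exact ⟨rfl, rfl, fun v hv => exists_triangleAt hG c hc
      (fun c hc u v x huv hx hx' => H c hc u v x x huv hx hx' (Or.inl ⟨rfl, le_rfl⟩)) hv⟩

end LowDegree
/-! ### The structure of extremal graphs -/

section Structure

variable {V : Type*}

/-- `c` is the centre of a component that is a star with `N` edges. -/
def StarAt (G : SimpleGraph V) (N : ℕ) (c : V) : Prop :=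
  (G.neighborSet c).ncard = N ∧ ∀ x, G.Adj c x → G.neighborSet x = {c}

/-- The vertices `x`, `y`, `z`, `w` span, in this order, a component that is a four-cycle. -/
def FourCycleAt (G : SimpleGraph V) (x y z w : V) : Prop :=
  x ≠ z ∧ y ≠ w ∧ G.neighborSet x = {y, w} ∧ G.neighborSet y = {x, z} ∧
    G.neighborSet z = {y, w} ∧ G.neighborSet w = {x, z}

/-- The component of `v` is a star with `n + m - 1` edges, or one of the exceptional components. -/
def IsLocallyExtremal (G : SimpleGraph V) (n m : ℕ) (v : V) : Prop :=
  (∃ c, StarAt G (n + m - 1) c ∧ (v = c ∨ G.Adj c v)) ∨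
    (n = 2 ∧ m = 2 ∧ ∃ y z, TriangleAt G v y z) ∨
    (n = 2 ∧ m = 1 ∧ ∃ y z w, FourCycleAt G v y z w)

theorem neighborSet_del {G : SimpleGraph V} {v x : V} (h : x ≠ v) :
    (del G {v}).neighborSet x = G.neighborSet x \ {v} := by
  ext w
  simp [del, h]

theorem neighborSet_del_of_not_adj {G : SimpleGraph V} {v x : V} (h : x ≠ v) (hv : ¬ G.Adj x v) :
    (del G {v}).neighborSet x = G.neighborSet x := by
  rw [neighborSet_del h]
  exact Set.sdiff_singleton_eq_self hv

theorem ncard_neighborSet_del [Finite V] {G : SimpleGraph V} {v x : V} (h : G.Adj x v) :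
    ((del G {v}).neighborSet x).ncard + 1 = (G.neighborSet x).ncard := by
  rw [neighborSet_del h.ne]
  exact Set.ncard_sdiff_singleton_add_one h (Set.toFinite _)

theorem TriangleAt.ncard {G : SimpleGraph V} {x y z : V} (h : TriangleAt G x y z) :
    (G.neighborSet x).ncard = 2 := by
  rw [h.1, Set.ncard_pair]
  rintro rfl
  have : y ∈ G.neighborSet y := by rw [h.2.1]; simp
  exact G.loopless.irrefl y this

theorem FourCycleAt.ncard {G : SimpleGraph V} {x y z w : V} (h : FourCycleAt G x y z w) :
    (G.neighborSet x).ncard = 2 := by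
  rw [h.2.2.1, Set.ncard_pair h.2.1]

theorem FourCycleAt.ncard_of_adj {G : SimpleGraph V} {x y z w a : V} (h : FourCycleAt G x y z w)
    (ha : G.Adj x a) : (G.neighborSet a).ncard = 2 := by
  obtain ⟨hxz, hyw, h1, h2, h3, h4⟩ := h
  have ha' : a ∈ G.neighborSet x := ha
  rw [h1] at ha'
  rcases ha' with rfl | rfl
  · rw [h2, Set.ncard_pair hxz]
  · rw [h4, Set.ncard_pair hxz]

theorem mem_pair_of_mem_del {G : SimpleGraph V} {u v x y : V} (hxv : x ≠ v)
    (h : (del G {v}).neighborSet x = {u}) (hxy : G.Adj x y) : y = u ∨ y = v := by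
  by_cases hy : y = v
  · exact Or.inr hy
  · have : y ∈ (del G {v}).neighborSet x := ⟨hxy, hxv, hy⟩
    rw [h] at this
    exact Or.inl this

/-- Two disjoint triangles in `G - v` and `G - x`, as they arise for adjacent vertices `v` and `x` of
degree three. -/
theorem exists_closed_of_triangleAt [Finite V] {G : SimpleGraph V} {v x y z p q : V}
    (hvx : G.Adj v x) (h1 : TriangleAt (del G {v}) x y z) (h2 : TriangleAt (del G {x}) v p q)
    (h3 : ∀ a, (∃ w, (del G {v}).Adj a w) → IsLocallyExtremal (del G {v}) 2 2 a) :
    ∃ U : Set V, v ∈ U ∧ x ∈ U ∧ U.ncard ≤ 4 ∧ ∀ a b, a ∈ U → G.Adj a b → b ∈ U := by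
  obtain ⟨hx, hy, hz⟩ := h1
  obtain ⟨hv, hp, hq⟩ := h2
  have mem1 : ∀ a b, (del G {v}).Adj a b ↔ b ∈ (del G {v}).neighborSet a := fun _ _ => Iff.rfl
  have mem2 : ∀ a b, (del G {x}).Adj a b ↔ b ∈ (del G {x}).neighborSet a := fun _ _ => Iff.rfl
  have hpq : (del G {x}).Adj p q := by rw [mem2, hp]; simp
  have hvp : (del G {x}).Adj v p := by rw [mem2, hv]; simp
  have hvq : (del G {x}).Adj v q := by rw [mem2, hv]; simp
  have hxy : (del G {v}).Adj x y := by rw [mem1, hx]; simp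
  have hpq' : (del G {v}).Adj p q := ⟨hpq.1, hvp.1.ne', hvq.1.ne'⟩
  -- Otherwise `p` and `q` would have degree one in `G - v`, making `pq` a single-edge component,
  -- whereas the nontrivial components there are triangles and stars with three edges. Hence `v`,
  -- `x`, `y`, `z` span a complete component.
  have key : (p = y ∧ q = z) ∨ (p = z ∧ q = y) := by
    have hp1 : p = y → q = z := by
      rintro rfl
      have := (mem1 _ _).1 hpq'
      rw [hy] at this
      exact this.resolve_left hpq.2.2
    have hp2 : p = z → q = y := by
      rintro rfl
      have := (mem1 _ _).1 hpq'
      rw [hz] at this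
      exact this.resolve_left hpq.2.2
    have hq1 : q = y → p = z := by
      rintro rfl
      have := (mem1 _ _).1 hpq'.symm
      rw [hy] at this
      exact this.resolve_left hpq.2.1
    have hq2 : q = z → p = y := by
      rintro rfl
      have := (mem1 _ _).1 hpq'.symm
      rw [hz] at this
      exact this.resolve_left hpq.2.1
    by_contra hne
    have hpy : p ≠ y := fun h => hne (Or.inl ⟨h, hp1 h⟩)
    have hpz : p ≠ z := fun h => hne (Or.inr ⟨h, hp2 h⟩)
    have hqy : q ≠ y := fun h => hpz (hq1 h)
    have hqz : q ≠ z := fun h => hpy (hq2 h)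
    have single : ∀ a b, a ≠ y → a ≠ z → a ≠ x → (del G {x}).neighborSet a = {v, b} →
        (del G {v}).neighborSet a ⊆ {b} := by
      intro a b hay haz hax hN d hd
      have hdx : d ≠ x := by
        rintro rfl
        have := (mem1 _ _).1 (show (del G {v}).Adj d a from hd.symm)
        rw [hx] at this
        exact this.elim hay haz
      have : d ∈ (del G {x}).neighborSet a := ⟨hd.1, hax, hdx⟩
      rw [hN] at this
      exact this.resolve_left hd.2.2
    have hNp := single p q hpy hpz hpq.2.1 hp
    have hNq := single q p hqy hqz hpq.2.2 hq
    have hcp := Set.ncard_le_ncard hNp (Set.toFinite _)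
    have hcq := Set.ncard_le_ncard hNq (Set.toFinite _)
    rw [Set.ncard_singleton] at hcp hcq
    rcases h3 p ⟨q, hpq'⟩ with ⟨c, hc, rfl | hcp'⟩ | ⟨-, -, y', z', h⟩ | ⟨-, h, -⟩
    · have := hc.1
      omega
    · obtain rfl : c = q := hNp hcp'.symm
      have := hc.1
      omega
    · have := h.ncard
      omega
    · omega
  have hv' : (del G {x}).neighborSet v = {y, z} := by
    rcases key with ⟨rfl, rfl⟩ | ⟨rfl, rfl⟩
    exacts [hv, hv.trans (Set.pair_comm _ _)]
  refine ⟨{v, x, y, z}, by simp, by simp, ?_, ?_⟩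
  · refine (Set.ncard_insert_le _ _).trans ?_
    refine Nat.succ_le_succ ((Set.ncard_insert_le _ _).trans ?_)
    refine Nat.succ_le_succ ((Set.ncard_insert_le _ _).trans ?_)
    rw [Set.ncard_singleton]
  · have hstep : ∀ a b, a ≠ v → (del G {v}).neighborSet a ⊆ {v, x, y, z} → G.Adj a b →
        b ∈ ({v, x, y, z} : Set V) := by
      intro a b hav hN hab
      by_cases hb : b = v
      · exact Or.inl hb
      · exact hN ⟨hab, hav, hb⟩
    have hzv : z ≠ v := by
      have : (del G {v}).Adj x z := by rw [mem1, hx]; simp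
      exact this.2.2
    rintro a b (rfl | rfl | rfl | rfl) hab
    · by_cases hb : b = x
      · exact Or.inr (Or.inl hb)
      · have : b ∈ (del G {x}).neighborSet a := ⟨hab, hvx.ne, hb⟩
        rw [hv'] at this
        exact Or.inr (Or.inr this)
    · exact hstep a b hxy.2.1 (by rw [hx]; simp [Set.insert_subset_iff]) hab
    · exact hstep a b hxy.2.2 (by rw [hy]; simp [Set.insert_subset_iff]) hab
    · exact hstep a b hzv (by rw [hz]; simp [Set.insert_subset_iff]) hab

/-- The component of a vertex of maximum degree. -/
theorem starAt_or_fourCycleAt [Finite V] {G : SimpleGraph V} {n m : ℕ}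
    (hdeg : ∀ v, (G.neighborSet v).ncard ≤ n + m - 1)
    (hdel : ∀ v, (G.neighborSet v).ncard = n + m - 1 → ∀ a, (∃ w, (del G {v}).Adj a w) →
      IsLocallyExtremal (del G {v}) n m a)
    (hsmall : n = 2 → m = 2 → ∀ U : Set V, (∀ a b, a ∈ U → G.Adj a b → b ∈ U) → U.ncard ≤ 4 →
      ∀ u ∈ U, ∀ v ∈ U, G.Adj u v → (G.neighborSet u).ncard = 3 → (G.neighborSet v).ncard = 3 →
      False)
    (hpair : ∀ u v w, u ≠ v → ¬ G.Adj u v → (G.neighborSet u).ncard = n + m - 1 →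
      (G.neighborSet v).ncard = n + m - 1 → G.Adj u w → G.Adj v w →
      (∀ a b, (G.Adj u a ∨ G.Adj v a) → G.Adj a b → b = u ∨ b = v) →
      n = 2 ∧ m = 1 ∧ G.neighborSet u = G.neighborSet v)
    {v : V} (hv : (G.neighborSet v).ncard = n + m - 1) :
    StarAt G (n + m - 1) v ∨ (n = 2 ∧ m = 1 ∧ ∃ y z w, FourCycleAt G v y z w) := by
  by_cases hstar : StarAt G (n + m - 1) v
  · exact Or.inl hstar
  obtain ⟨x, hvx, hx⟩ : ∃ x, G.Adj v x ∧ G.neighborSet x ≠ {v} := by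
    unfold StarAt at hstar
    push Not at hstar
    exact hstar hv
  obtain ⟨u, hxu, huv⟩ : ∃ u, G.Adj x u ∧ u ≠ v := by
    by_contra! hall
    exact hx (Set.eq_singleton_iff_unique_mem.2 ⟨hvx.symm, hall⟩)
  have hxv := hvx.ne'
  -- With the edge to `b` restored, the degree of `a` would exceed the maximum.
  have hover : ∀ {a b}, G.Adj a b → ((del G {b}).neighborSet a).ncard ≠ n + m - 1 := by
    intro a b hab h
    have := ncard_neighborSet_del hab
    have := hdeg a
    omega
  rcases hdel v hv x ⟨u, hxu, hxv, huv⟩ with ⟨c, hc, rfl | hcx⟩ | ⟨rfl, rfl, y, z, htri⟩ |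
    ⟨rfl, rfl, y, z, w, hcyc⟩
  · exact absurd hc.1 (hover hvx.symm)
  -- Here `x` is a leaf of a star of `G - v` with centre `c`. Since `c` also has full degree in `G`,
  -- the roles of `c` and `v` can be exchanged.
  · have hcv : c ≠ v := hcx.2.1
    have hncv : ¬ G.Adj c v := fun h => hover h hc.1
    have hcdeg : (G.neighborSet c).ncard = n + m - 1 := by
      rw [← neighborSet_del_of_not_adj hcv hncv]
      exact hc.1
    have hvdel := neighborSet_del_of_not_adj hcv.symm fun h => hncv h.symm
    rcases hdel c hcdeg v ⟨x, hvx, hcv.symm, hcx.1.ne'⟩ with ⟨c', hc', rfl | hcv'⟩ |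
      ⟨rfl, rfl, y, z, htri⟩ | ⟨rfl, rfl, y, z, w, hcyc⟩
    · have hnb : ∀ a b, (G.Adj c a ∨ G.Adj v a) → G.Adj a b → b = c ∨ b = v := by
        rintro a b (ha | ha) hab
        · have hav : a ≠ v := fun h => hncv (h ▸ ha)
          exact mem_pair_of_mem_del hav (hc.2 a ⟨ha, hcv, hav⟩) hab
        · have hac : a ≠ c := fun h => hncv (h ▸ ha).symm
          exact (mem_pair_of_mem_del hac (hc'.2 a ⟨ha, hcv.symm, hac⟩) hab).symm
      obtain ⟨rfl, rfl, hN⟩ := hpair c v x hcv hncv hcdeg hv hcx.1 hvx hnb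
      obtain ⟨x', hxx', hNv⟩ : ∃ x', x ≠ x' ∧ G.neighborSet v = {x, x'} := by
        obtain ⟨a, b, hab, hN'⟩ := Set.ncard_eq_two.1 hv
        have hx' : x ∈ G.neighborSet v := hvx
        rw [hN'] at hx'
        rcases hx' with rfl | rfl
        exacts [⟨b, hab, hN'⟩, ⟨a, hab.symm, hN'.trans (Set.pair_comm _ _)⟩]
      have hvx' : G.Adj v x' := by
        rw [← SimpleGraph.mem_neighborSet, hNv]; simp
      have hNx : ∀ a, G.Adj v a → G.neighborSet a = {v, c} := by
        intro a ha
        ext b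
        constructor
        · exact fun hb => (hnb a b (Or.inr ha) hb).symm
        · have hca : G.Adj c a := by
            rw [← SimpleGraph.mem_neighborSet, hN]; exact ha
          rintro (rfl | rfl)
          exacts [ha.symm, hca.symm]
      exact Or.inr ⟨rfl, rfl, x, c, x', hcv.symm, hxx', hNv, hNx x hvx, hN.trans hNv, hNx x' hvx'⟩
    · have hx' : x ∈ (del G {c}).neighborSet v := ⟨hvx, hcv.symm, hcx.1.ne'⟩
      rw [hc'.2 v hcv'] at hx'
      obtain rfl : x = c' := hx'
      exact absurd hc'.1 (hover hcx.1.symm)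
    · have := htri.ncard
      rw [hvdel] at this
      omega
    · have := hcyc.ncard_of_adj (a := x) ⟨hvx, hcv.symm, hcx.1.ne'⟩
      exact absurd this (hover hcx.1.symm)
  -- Here `x` lies in a triangle of `G - v` and so has degree three in `G`. In `G - x` the vertex
  -- `v` must lie in a triangle too, and the two triangles give a closed set of at most four
  -- vertices.
  · exfalso
    have hxdeg : (G.neighborSet x).ncard = 3 := by
      rw [← ncard_neighborSet_del hvx.symm, htri.ncard]
    have hv2 := ncard_neighborSet_del hvx
    obtain ⟨w, hw⟩ := (Set.ncard_pos (Set.toFinite _)).1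
      (show 0 < ((del G {x}).neighborSet v).ncard by omega)
    rcases hdel x hxdeg v ⟨w, hw⟩ with ⟨c, hc, rfl | hcv⟩ | ⟨-, -, p, q, htri'⟩ | ⟨-, h, -⟩
    · exact hover hvx hc.1
    · have h1 := hc.2 v hcv
      rw [h1, Set.ncard_singleton] at hv2
      omega
    · obtain ⟨U, hvU, hxU, hU, hUc⟩ := exists_closed_of_triangleAt hvx htri htri' (hdel v hv)
      exact hsmall rfl rfl U hUc hU v hvU x hxU hvx hv hxdeg
    · omega
  · exact absurd hcyc.ncard (hover hvx.symm)

/-- A vertex of full degree, or adjacent to one, is settled by `hmax`. Any other vertex keeps its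
neighbourhood in `G - v`; there it is a leaf, whose centre has full degree in `G`, or in a triangle,
which `v` does not touch because `v` is the centre of a star component. -/
theorem isLocallyExtremal_of_del [Finite V] {G : SimpleGraph V} {n m : ℕ} (hN : 0 < n + m - 1)
    (hdeg : ∀ v, (G.neighborSet v).ncard ≤ n + m - 1)
    (hdel : ∀ v, (G.neighborSet v).ncard = n + m - 1 → ∀ a, (∃ w, (del G {v}).Adj a w) →
      IsLocallyExtremal (del G {v}) n m a)
    (hmax : ∀ v, (G.neighborSet v).ncard = n + m - 1 →
      StarAt G (n + m - 1) v ∨ (n = 2 ∧ m = 1 ∧ ∃ y z w, FourCycleAt G v y z w))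
    {v : V} (hv : (G.neighborSet v).ncard = n + m - 1) (a : V) (ha : ∃ w, G.Adj a w) :
    IsLocallyExtremal G n m a := by
  by_cases hadeg : (G.neighborSet a).ncard = n + m - 1
  · rcases hmax a hadeg with h | h
    · exact Or.inl ⟨a, h, Or.inl rfl⟩
    · exact Or.inr (Or.inr h)
  have hav : a ≠ v := by rintro rfl; exact hadeg hv
  have hadj : ∀ c, (G.neighborSet c).ncard = n + m - 1 → G.Adj c a → IsLocallyExtremal G n m a := by
    intro c hc hca
    rcases hmax c hc with h | ⟨rfl, rfl, y, z, w, h⟩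
    · exact Or.inl ⟨c, h, Or.inr hca⟩
    · exact absurd (h.ncard_of_adj hca) hadeg
  by_cases hva : G.Adj v a
  · exact hadj v hv hva
  have hadel := neighborSet_del_of_not_adj hav fun h => hva h.symm
  obtain ⟨w, hw⟩ := ha
  have hover : ∀ {a b}, G.Adj a b → ((del G {b}).neighborSet a).ncard ≠ n + m - 1 := by
    intro a b hab h
    have := ncard_neighborSet_del hab
    have := hdeg a
    omega
  rcases hdel v hv a ⟨w, by rw [← SimpleGraph.mem_neighborSet, hadel]; exact hw⟩ with
    ⟨c, hc, rfl | hca⟩ | ⟨rfl, rfl, y, z, htri⟩ | ⟨rfl, rfl, y, z, w, hcyc⟩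
  · rw [← hadel] at hadeg
    exact absurd hc.1 hadeg
  · refine hadj c ?_ hca.1
    have hcv : c ≠ v := hca.2.1
    rw [← neighborSet_del_of_not_adj hcv fun h => hover h hc.1]
    exact hc.1
  · have hstar := (hmax v hv).resolve_right (by omega)
    obtain ⟨h1, h2, h3⟩ := htri
    have hnadj : ∀ b, (del G {v}).Adj b a → b ≠ v ∧ ¬ G.Adj b v := by
      refine fun b hb => ⟨hb.2.1, fun h => hb.2.2 ?_⟩
      have : a ∈ G.neighborSet b := hb.1
      rwa [hstar.2 b h.symm] at this
    have hy := hnadj y (by rw [← SimpleGraph.mem_neighborSet, h2]; simp)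
    have hz := hnadj z (by rw [← SimpleGraph.mem_neighborSet, h3]; simp)
    rw [hadel] at h1
    rw [neighborSet_del_of_not_adj hy.1 hy.2] at h2
    rw [neighborSet_del_of_not_adj hz.1 hz.2] at h3
    exact Or.inr (Or.inl ⟨rfl, rfl, y, z, h1, h2, h3⟩)
  · rw [← hadel] at hadeg
    exact absurd hcyc.ncard hadeg

/-- The lower bound on the number of edges of an arrowing graph, and the components of the graphs
that attain it. -/
theorem ArrowsStars.le_ncard_edgeSet [Finite V] {n m : ℕ} (hm : 0 < m) (hmn : m ≤ n) (k : ℕ) :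
    ∀ (s t : ℕ), 0 < s → 0 < t → s + t = k + 1 → ∀ G : SimpleGraph V, ArrowsStars G n m s t →
      k * (n + m - 1) ≤ G.edgeSet.ncard ∧ (G.edgeSet.ncard = k * (n + m - 1) →
        ∀ a, (∃ w, G.Adj a w) → IsLocallyExtremal G n m a) := by
  induction k with
  | zero => intro s t hs ht hst; omega
  | succ k ih =>
    intro s t hs ht hst G h
    by_cases hG : ∀ v, (G.neighborSet v).ncard < n + m - 1
    · obtain ⟨h1, h2⟩ := h.of_degree_lt hs ht hm hmn hG
      rw [show s + t - 1 = k + 1 by omega] at h1 h2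
      exact ⟨h1, fun heq a ha =>
        Or.inr (Or.inl ⟨(h2 heq).1, (h2 heq).2.1, (h2 heq).2.2 a ha⟩)⟩
    push Not at hG
    obtain ⟨v, hv⟩ := hG
    have hsplit : k = 0 ∨ (∃ s', 0 < s' ∧ s = s' + 1 ∧ s' + t = k + 1) ∨
        (∃ t', 0 < t' ∧ t = t' + 1 ∧ s + t' = k + 1) := by
      by_cases hs1 : 2 ≤ s
      · exact Or.inr (Or.inl ⟨s - 1, by omega, by omega, by omega⟩)
      · by_cases ht1 : 2 ≤ t
        · exact Or.inr (Or.inr ⟨t - 1, by omega, by omega, by omega⟩)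
        · exact Or.inl (by omega)
    -- For `s = t = 1` the degree of `v` alone gives the bound, and equality means that every edge
    -- meets `v`.
    rcases Nat.eq_zero_or_pos k with rfl | hk
    · have hcard := ncard_edgeSet_del_singleton G v
      refine ⟨by omega, fun heq a ha => ?_⟩
      have hempty : (del G {v}).edgeSet = ∅ := (Set.ncard_eq_zero (Set.toFinite _)).1 (by omega)
      have hinc : ∀ x y, G.Adj x y → x = v ∨ y = v := by
        intro x y hxy
        by_contra! hne
        have : s(x, y) ∈ (del G {v}).edgeSet := ⟨hxy, hne⟩
        rw [hempty] at this
        exact this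
      refine Or.inl ⟨v, ⟨by omega, ?_⟩, ?_⟩
      · intro x hvx
        exact Set.eq_singleton_iff_unique_mem.2
          ⟨hvx.symm, fun y hxy => (hinc x y hxy).resolve_left hvx.ne'⟩
      · obtain ⟨w, hw⟩ := ha
        rcases hinc a w hw with rfl | rfl
        exacts [Or.inl rfl, Or.inr hw.symm]
    · have hdel : ∀ v, k * (n + m - 1) ≤ (del G {v}).edgeSet.ncard ∧
          ((del G {v}).edgeSet.ncard = k * (n + m - 1) →
            ∀ a, (∃ w, (del G {v}).Adj a w) → IsLocallyExtremal (del G {v}) n m a) := by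
        intro v
        rcases hsplit with h0 | ⟨s', hs', rfl, hst'⟩ | ⟨t', ht', rfl, hst'⟩
        · omega
        · exact ih s' t hs' ht hst' _ (h.del_vertex hm v)
        · exact ih s t' hs ht' hst' _ (h.del_vertex' (by omega) v)
      have hmul : (k + 1) * (n + m - 1) = k * (n + m - 1) + (n + m - 1) := by ring
      have hcard := ncard_edgeSet_del_singleton G
      refine ⟨?_, fun heq => ?_⟩
      · have := hcard v
        have := (hdel v).1
        omega
      · have hdeg : ∀ v, (G.neighborSet v).ncard ≤ n + m - 1 := fun v => by
          have := hcard v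
          have := (hdel v).1
          omega
        have hdel' : ∀ v, (G.neighborSet v).ncard = n + m - 1 → ∀ a, (∃ w, (del G {v}).Adj a w) →
            IsLocallyExtremal (del G {v}) n m a := fun v hv => (hdel v).2 (by
          have := hcard v
          omega)
        refine isLocallyExtremal_of_del (by omega) hdeg hdel' (fun v hv =>
          starAt_or_fourCycleAt hdeg hdel' ?_ ?_ hv) (le_antisymm (hdeg v) hv)
        -- Removing `U` costs one star, which is worth three edges, but the adjacent vertices `u`
        -- and `v` carry five.
        · rintro rfl rfl U hUc hU u hu v hv huv hudeg hvdeg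
          have h1 : k * (2 + 2 - 1) ≤ (del G U).edgeSet.ncard := by
            rcases hsplit with h0 | ⟨s', hs', rfl, hst'⟩ | ⟨t', ht', rfl, hst'⟩
            · omega
            · exact (ih s' t hs' ht hst' _ (h.del_small hm hUc (by omega))).1
            · exact (ih s t' hs ht' hst' _ (h.swap.del_small hm hUc (by omega)).swap).1
          have h2 := ncard_edgeSet_del_pair G hu hv
          have h3 := ncard_neighborSet_del huv.symm
          omega
        -- The vertices `u` and `v` carry `2 * (n + m - 1)` edges and cost one star. As `m ≤ n`, the
        -- exception in `del_pair` can arise only with the colours exchanged, that is for `n = 2`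
        -- and `m = 1`.
        · intro u v w huv hnadj hu hv huw hvw hnb
          by_contra hne
          have h1 : k * (n + m - 1) ≤ (del G
              ({u, v} ∪ G.neighborSet u ∪ G.neighborSet v)).edgeSet.ncard := by
            rcases hsplit with h0 | ⟨s', hs', rfl, hst'⟩ | ⟨t', ht', rfl, hst'⟩
            · omega
            · exact (ih s' t hs' ht hst' _ (h.del_pair (by omega) hm huv hnadj hu hv huw hvw hnb
                (by omega))).1
            · refine (ih s t' hs ht' hst' _ (h.swap.del_pair hm (by omega) huv hnadj (by omega)
                (by omega) huw hvw hnb ?_).swap).1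
              rintro ⟨h1, h2, h3⟩
              exact hne ⟨h2, h1, h3⟩
          have h2 := ncard_edgeSet_del_pair G
            (U := {u, v} ∪ G.neighborSet u ∪ G.neighborSet v) (u := u) (v := v)
            (by simp) (by simp)
          rw [neighborSet_del_of_not_adj huv.symm fun h => hnadj h.symm] at h2
          clear hsplit
          omega

/-- If there are at least two red stars then four-cycles are not extremal. -/
theorem ArrowsStars.not_fourCycleAt [Finite V] {G : SimpleGraph V} {s t : ℕ} (hs : 2 ≤ s)
    (ht : 0 < t) (h : ArrowsStars G 2 1 s t) (heq : G.edgeSet.ncard = (s + t - 1) * 2)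
    (x y z w : V) : ¬ FourCycleAt G x y z w := by
  rintro ⟨hxz, hyw, h1, h2, h3, h4⟩
  obtain ⟨s', rfl⟩ : ∃ s', s = s' + 1 := ⟨s - 1, by omega⟩
  have hUc : ∀ a b, a ∈ ({x, z, y, w} : Set V) → G.Adj a b → b ∈ ({x, z, y, w} : Set V) := by
    have : ∀ a b, G.Adj a b ↔ b ∈ G.neighborSet a := fun _ _ => Iff.rfl
    rintro a b (rfl | rfl | rfl | rfl) hab <;> rw [this] at hab <;>
      simp only [h1, h2, h3, h4, Set.mem_insert_iff, Set.mem_singleton_iff] at hab ⊢ <;> tauto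
  have hU : ({x, z, y, w} : Set V).ncard ≤ 4 := by
    refine (Set.ncard_insert_le _ _).trans ?_
    refine Nat.succ_le_succ ((Set.ncard_insert_le _ _).trans ?_)
    refine Nat.succ_le_succ ((Set.ncard_insert_le _ _).trans ?_)
    rw [Set.ncard_singleton]
  -- Four vertices cannot hold two disjoint red stars with two edges, so the cycle costs one red
  -- star, worth two edges, while it has four.
  have h5 := (ArrowsStars.le_ncard_edgeSet one_pos one_le_two (s' + t - 1) s' t (by omega) ht
    (by omega) _ (h.del_small one_pos hUc (by omega))).1
  have h6 := ncard_edgeSet_del_pair G (U := {x, z, y, w}) (u := x) (v := z) (by simp) (by simp)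
  have hnadj : ¬ G.Adj z x := by
    intro hzx
    have hx : x ∈ G.neighborSet z := hzx
    rw [h3, ← h1] at hx
    exact G.loopless.irrefl x hx
  rw [neighborSet_del_of_not_adj hxz.symm hnadj, h1, h3, Set.ncard_pair hyw] at h6
  omega

end Structure
/-! ### Disjoint unions -/

section DisjointUnions

variable {V W : Type*}

/-- Copies of a graph can be split into two groups. -/
def copiesAddIso (a b : ℕ) (H : SimpleGraph W) :
    copies a H ⊕g copies b H ≃g copies (a + b) H where
  toEquiv := (Equiv.sumProdDistrib (Fin a) (Fin b) W).symm.trans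
    (Equiv.prodCongr finSumFinEquiv (Equiv.refl W))
  map_rel_iff' := by
    rintro (⟨i, x⟩ | ⟨i, x⟩) (⟨j, y⟩ | ⟨j, y⟩) <;>
      simp [copies, Fin.ext_iff] <;> omega

/-- One copy of a graph. -/
def copiesOneIso (H : SimpleGraph W) : copies 1 H ≃g H where
  toEquiv := Equiv.uniqueProd W (Fin 1)
  map_rel_iff' := by
    rintro ⟨i, x⟩ ⟨j, y⟩
    obtain rfl := Subsingleton.elim i j
    simp [copies]

theorem ncard_edgeSet_congr {G : SimpleGraph V} {H : SimpleGraph W} (e : G ≃g H) :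
    G.edgeSet.ncard = H.edgeSet.ncard := by
  rw [← Nat.card_coe_set_eq, ← Nat.card_coe_set_eq]
  exact Nat.card_congr e.mapEdgeSet

theorem ncard_edgeSet_sum [Finite V] [Finite W] (G : SimpleGraph V) (H : SimpleGraph W) :
    (G ⊕g H).edgeSet.ncard = G.edgeSet.ncard + H.edgeSet.ncard := by
  rw [← Nat.card_coe_set_eq, ← Nat.card_coe_set_eq, ← Nat.card_coe_set_eq, ← Nat.card_sum]
  exact Nat.card_congr SimpleGraph.edgeSetSumEquiv

theorem ncard_edgeSet_copies [Finite W] (k : ℕ) (H : SimpleGraph W) :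
    (copies k H).edgeSet.ncard = k * H.edgeSet.ncard := by
  induction k with
  | zero =>
    rw [Nat.zero_mul, Set.ncard_eq_zero (Set.toFinite _)]
    refine Set.eq_empty_of_forall_notMem fun e => ?_
    induction e using Sym2.inductionOn with
    | _ x y => exact x.1.elim0
  | succ k ih =>
    rw [← ncard_edgeSet_congr (copiesAddIso k 1 H), ncard_edgeSet_sum, ih,
      ncard_edgeSet_congr (copiesOneIso H), Nat.succ_mul]

theorem ncard_edgeSet_star (N : ℕ) : (star N).edgeSet.ncard = N := by
  rw [Set.ncard_def, SimpleGraph.encard_edgeSet_completeBipartiteGraph]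
  simp

theorem ncard_edgeSet_triangle : (SimpleGraph.completeGraph (Fin 3)).edgeSet.ncard = 3 := by
  rw [← SimpleGraph.coe_edgeFinset, Set.ncard_coe_finset]
  rfl

theorem ncard_edgeSet_fourCycle : (SimpleGraph.cycleGraph 4).edgeSet.ncard = 4 := by
  rw [← SimpleGraph.coe_edgeFinset, Set.ncard_coe_finset]
  have := (SimpleGraph.cycleGraph 4).sum_degrees_eq_twice_card_edges
  simp only [SimpleGraph.cycleGraph_degree_three_le, Finset.sum_const, Finset.card_univ,
    Fintype.card_fin, smul_eq_mul] at this
  omega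

theorem HasStars.sum {G : SimpleGraph V} {H : SimpleGraph W} {R : SimpleGraph (V ⊕ W)} {n p q : ℕ}
    (hG : HasStars G n (Fin p)) (hH : HasStars H n (Fin q))
    (hGR : ∀ a b, G.Adj a b → R.Adj (.inl a) (.inl b))
    (hHR : ∀ a b, H.Adj a b → R.Adj (.inr a) (.inr b)) : HasStars R n (Fin (p + q)) := by
  obtain ⟨c, L, h1, h2⟩ := hG
  obtain ⟨c', L', h1', h2'⟩ := hH
  have hdisj : ∀ i j, Disjoint (Sum.inl '' starVerts (c i) (L i) : Set (V ⊕ W))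
      (Sum.inr '' starVerts (c' j) (L' j)) := fun i j => by
    rw [Set.disjoint_left]
    rintro _ ⟨x, -, rfl⟩ ⟨y, -, h⟩
    cases h
  refine HasStars.of_injective (ι := Fin p ⊕ Fin q) ?_ finSumFinEquiv.symm.injective
  refine ⟨Sum.elim (fun i => .inl (c i)) (fun j => .inr (c' j)),
    Sum.elim (fun i => (L i).map .inl) (fun j => (L' j).map .inr), ?_, ?_⟩
  · rintro (i | j)
    exacts [(h1 i).map .inl hGR, (h1' j).map .inr hHR]
  · rintro (i | i) (j | j) hij
    · have := h2 i j fun h => hij (congrArg _ h)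
      rwa [← Set.disjoint_image_iff (Function.Embedding.inl (β := W)).injective, ← starVerts_map,
        ← starVerts_map] at this
    · change Disjoint (starVerts (Function.Embedding.inl (c i)) ((L i).map .inl))
        (starVerts (Function.Embedding.inr (c' j)) ((L' j).map .inr))
      rw [starVerts_map, starVerts_map]
      exact hdisj i j
    · change Disjoint (starVerts (Function.Embedding.inr (c' i)) ((L' i).map .inr))
        (starVerts (Function.Embedding.inl (c j)) ((L j).map .inl))
      rw [starVerts_map, starVerts_map]
      exact (hdisj j i).symm
    · have := h2' i j fun h => hij (congrArg _ h)
      rwa [← Set.disjoint_image_iff (Function.Embedding.inr (α := V)).injective, ← starVerts_map,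
        ← starVerts_map] at this

theorem hasStars_zero (R : SimpleGraph V) (n : ℕ) : HasStars R n (Fin 0) :=
  ⟨Fin.elim0, Fin.elim0, fun i => i.elim0, fun i => i.elim0⟩

theorem hasStars_one {R : SimpleGraph V} {n : ℕ} {c : V} {L : Finset V} (h : IsStar R n c L) :
    HasStars R n (Fin 1) :=
  ⟨fun _ => c, fun _ => L, fun _ => h, fun i j hij => absurd (Subsingleton.elim i j) hij⟩

theorem HasStars.mono {R : SimpleGraph V} {n s s' : ℕ} (h : HasStars R n (Fin s)) (hs : s' ≤ s) :
    HasStars R n (Fin s') :=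
  h.of_injective (Fin.castLE_injective hs)

/-- The restriction of a colouring of a disjoint union to its two parts. -/
theorem exists_sum_parts {G : SimpleGraph V} {H : SimpleGraph W} {R : SimpleGraph (V ⊕ W)}
    (hR : R ≤ G ⊕g H) : ∃ R₁ ≤ G, ∃ R₂ ≤ H,
      (∀ {n p q}, HasStars R₁ n (Fin p) → HasStars R₂ n (Fin q) → HasStars R n (Fin (p + q))) ∧
      ∀ {n p q}, HasStars (G \ R₁) n (Fin p) → HasStars (H \ R₂) n (Fin q) →
        HasStars ((G ⊕g H) \ R) n (Fin (p + q)) := by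
  refine ⟨R.comap Sum.inl, fun a b h => ?_, R.comap Sum.inr, fun a b h => ?_, fun h h' =>
    h.sum h' (fun _ _ h => h) fun _ _ h => h, fun h h' => h.sum h' (fun _ _ h => ?_) fun _ _ h => ?_⟩
  · exact SimpleGraph.sum_adj_inl.1 (hR h)
  · exact SimpleGraph.sum_adj_inr.1 (hR h)
  · exact ⟨SimpleGraph.sum_adj_inl.2 h.1, h.2⟩
  · exact ⟨SimpleGraph.sum_adj_inr.2 h.1, h.2⟩

/-- `G → (sK_{1,n}, tK_{1,m})` for all `s` and `t` with `s + t = k + 1`. -/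
def ArrowsAll (G : SimpleGraph V) (n m k : ℕ) : Prop :=
  ∀ s t, s + t = k + 1 → ArrowsStars G n m s t

theorem arrowsAll_one {G : SimpleGraph V} {n m : ℕ} (h : ArrowsStars G n m 1 1) :
    ArrowsAll G n m 1 := by
  intro s t hst R hR
  obtain ⟨rfl, rfl⟩ | ⟨rfl, rfl⟩ | ⟨rfl, rfl⟩ : (s = 0 ∧ t = 2) ∨ (s = 1 ∧ t = 1) ∨
      (s = 2 ∧ t = 0) := by omega
  exacts [Or.inl (hasStars_zero _ _), h R hR, Or.inr (hasStars_zero _ _)]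

/-- Take `s` to be the largest number, up to `p`, of disjoint red stars; one more is impossible
unless `s = p`, so arrowing supplies the blue stars. Such pairs add up over disjoint unions, which
plain arrowing for one fixed pair does not show. -/
theorem ArrowsAll.exists_split {G R : SimpleGraph V} {n m p : ℕ} (h : ArrowsAll G n m p)
    (hR : R ≤ G) : ∃ s, HasStars R n (Fin s) ∧ HasStars (G \ R) m (Fin (p - s)) := by
  classical
  let P : ℕ → Prop := fun s => HasStars R n (Fin s)
  refine ⟨Nat.findGreatest P p,
    Nat.findGreatest_spec (P := P) (Nat.zero_le p) (hasStars_zero R n), ?_⟩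
  rcases (Nat.findGreatest_le (P := P) p).eq_or_lt with heq | hlt
  · rw [heq, Nat.sub_self]
    exact hasStars_zero _ _
  · exact (h (Nat.findGreatest P p + 1) (p - Nat.findGreatest P p) (by omega) R hR).resolve_left
      (Nat.findGreatest_is_greatest (P := P) (Nat.lt_succ_self _) hlt)

theorem ArrowsAll.sum {G : SimpleGraph V} {H : SimpleGraph W} {n m p q : ℕ}
    (hG : ArrowsAll G n m p) (hH : ArrowsAll H n m q) : ArrowsAll (G ⊕g H) n m (p + q) := by
  intro s t hst R hR
  obtain ⟨R₁, h1, R₂, h2, hred, hblue⟩ := exists_sum_parts hR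
  obtain ⟨a, ha, ha'⟩ := hG.exists_split h1
  obtain ⟨b, hb, hb'⟩ := hH.exists_split h2
  by_cases hab : s ≤ a + b
  · exact Or.inl ((hred ha hb).mono hab)
  · exact Or.inr ((hblue ha' hb').mono (by omega))

theorem ArrowsAll.iso {G : SimpleGraph V} {H : SimpleGraph W} {n m p : ℕ}
    (h : ArrowsAll G n m p) (e : G ≃g H) : ArrowsAll H n m p :=
  fun s t hst => (h s t hst).iso e

theorem arrowsAll_copies {H : SimpleGraph W} {n m : ℕ} (h : ArrowsStars H n m 1 1) (k : ℕ) :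
    ArrowsAll (copies k H) n m k := by
  induction k with
  | zero =>
    intro s t hst R _
    rcases Nat.eq_zero_or_pos s with rfl | hs
    · exact Or.inl (hasStars_zero _ _)
    · obtain rfl : t = 0 := by omega
      exact Or.inr (hasStars_zero _ _)
  | succ k ih =>
    exact (ih.sum ((arrowsAll_one h).iso (copiesOneIso H).symm)).iso (copiesAddIso k 1 H)

/-- Forcing one red star is additive in the number of blue stars. -/
theorem ArrowsStars.sum {G : SimpleGraph V} {H : SimpleGraph W} {n m p q : ℕ}
    (hG : ArrowsStars G n m 1 p) (hH : ArrowsStars H n m 1 q) :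
    ArrowsStars (G ⊕g H) n m 1 (p + q) := by
  intro R hR
  obtain ⟨R₁, h1, R₂, h2, hred, hblue⟩ := exists_sum_parts hR
  rcases hG R₁ h1 with hG' | hG'
  · exact Or.inl (hred hG' (hasStars_zero R₂ n))
  · rcases hH R₂ h2 with hH' | hH'
    · exact Or.inl (hred (hasStars_zero R₁ n) hH')
    · exact Or.inr (hblue hG' hH')

theorem arrowsStars_copies {H : SimpleGraph W} {n m p : ℕ} (h : ArrowsStars H n m 1 p) (k : ℕ) :
    ArrowsStars (copies k H) n m 1 (p * k) := by
  induction k with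
  | zero => exact fun R _ => Or.inr (hasStars_zero _ _)
  | succ k ih => exact (ih.sum (h.iso (copiesOneIso H).symm)).iso (copiesAddIso k 1 H)

/-! ### Arrowing properties of the building blocks -/

theorem arrowsStars_star {n m : ℕ} : ArrowsStars (star (n + m - 1)) n m 1 1 := by
  classical
  intro R hR
  have hcard := Finset.card_filter_add_card_filter_not (s := (Finset.univ : Finset (Fin (n + m - 1))))
    (fun i => R.Adj (.inl 0) (.inr i))
  rw [Finset.card_univ, Fintype.card_fin] at hcard
  by_cases h : n ≤ (Finset.univ.filter fun i : Fin (n + m - 1) => R.Adj (.inl 0) (.inr i)).card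
  · obtain ⟨A, hA, hAc⟩ := Finset.exists_subset_card_eq h
    refine Or.inl (hasStars_one (c := .inl 0) (L := A.map .inr)
      ⟨by rw [Finset.card_map, hAc], fun l hl => ?_⟩)
    obtain ⟨i, hi, rfl⟩ := Finset.mem_map.1 hl
    exact (Finset.mem_filter.1 (hA hi)).2
  · obtain ⟨A, hA, hAc⟩ := Finset.exists_subset_card_eq (show m ≤
      (Finset.univ.filter fun i : Fin (n + m - 1) => ¬ R.Adj (.inl 0) (.inr i)).card by omega)
    refine Or.inr (hasStars_one (c := .inl 0) (L := A.map .inr)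
      ⟨by rw [Finset.card_map, hAc], fun l hl => ?_⟩)
    obtain ⟨i, hi, rfl⟩ := Finset.mem_map.1 hl
    exact ⟨by simp, (Finset.mem_filter.1 (hA hi)).2⟩

theorem isStar_pair {R : SimpleGraph V} {c a b : V} (hab : a ≠ b) (ha : R.Adj c a)
    (hb : R.Adj c b) [DecidableEq V] : IsStar R 2 c {a, b} := by
  refine ⟨Finset.card_pair hab, fun l hl => ?_⟩
  rw [Finset.mem_insert, Finset.mem_singleton] at hl
  rcases hl with rfl | rfl
  exacts [ha, hb]

/-- Two of the three edges have the same colour, and any two edges of a triangle share a vertex. -/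
theorem arrowsStars_triangle : ArrowsStars (SimpleGraph.completeGraph (Fin 3)) 2 2 1 1 := by
  intro R _
  have hred : ∀ c a b : Fin 3, a ≠ b → R.Adj c a → R.Adj c b → HasStars R 2 (Fin 1) :=
    fun c a b hab ha hb => hasStars_one (isStar_pair hab ha hb)
  have hblue : ∀ c a b : Fin 3, a ≠ b → c ≠ a → c ≠ b → ¬ R.Adj c a → ¬ R.Adj c b →
      HasStars (SimpleGraph.completeGraph (Fin 3) \ R) 2 (Fin 1) :=
    fun c a b hab hca hcb ha hb => hasStars_one (L := {a, b})
      (isStar_pair hab (show _ ∧ _ from ⟨hca, ha⟩) (show _ ∧ _ from ⟨hcb, hb⟩))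
  have hsymm := R.adj_comm
  by_cases h01 : R.Adj 0 1
  · by_cases h02 : R.Adj 0 2
    · exact Or.inl (hred 0 1 2 (by decide) h01 h02)
    · by_cases h12 : R.Adj 1 2
      · exact Or.inl (hred 1 0 2 (by decide) h01.symm h12)
      · exact Or.inr (hblue 2 0 1 (by decide) (by decide) (by decide) (by rwa [hsymm])
          (by rwa [hsymm]))
  · by_cases h02 : R.Adj 0 2
    · by_cases h12 : R.Adj 1 2
      · exact Or.inl (hred 2 0 1 (by decide) h02.symm h12.symm)
      · exact Or.inr (hblue 1 0 2 (by decide) (by decide) (by decide) (by rwa [hsymm]) h12)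
    · exact Or.inr (hblue 0 1 2 (by decide) (by decide) (by decide) h01 h02)

/-- Without a red path of two edges the red edges form a matching, so one of the two pairs of
opposite edges is entirely blue. -/
theorem arrowsStars_fourCycle : ArrowsStars (SimpleGraph.cycleGraph 4) 2 1 1 2 := by
  intro R _
  have hred : ∀ c a b : Fin 4, a ≠ b → R.Adj c a → R.Adj c b → HasStars R 2 (Fin 1) :=
    fun c a b hab ha hb => hasStars_one (isStar_pair hab ha hb)
  have hblue : ∀ a b c d : Fin 4, a ≠ c → a ≠ d → b ≠ c → b ≠ d →
      (SimpleGraph.cycleGraph 4).Adj a b → (SimpleGraph.cycleGraph 4).Adj c d → ¬ R.Adj a b →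
      ¬ R.Adj c d → HasStars (SimpleGraph.cycleGraph 4 \ R) 1 (Fin 2) := by
    intro a b c d hac had hbc hbd hab hcd hnab hncd
    have hd : Disjoint (starVerts a {b}) (starVerts c {d}) := by
      rw [Set.disjoint_left]
      rintro x (rfl | hx) (h | h)
      · exact hac h
      · exact had (by simpa using h)
      · obtain rfl : x = b := by simpa using hx
        exact hbc h
      · obtain rfl : x = b := by simpa using hx
        exact hbd (by simpa using h)
    refine ⟨![a, c], ![{b}, {d}], ?_, ?_⟩
    · intro i
      fin_cases i
      · exact ⟨by simp, fun l hl => by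
          obtain rfl : l = b := by simpa using hl
          exact ⟨hab, hnab⟩⟩
      · exact ⟨by simp, fun l hl => by
          obtain rfl : l = d := by simpa using hl
          exact ⟨hcd, hncd⟩⟩
    · intro i j hij
      fin_cases i <;> fin_cases j
      exacts [absurd rfl hij, hd, hd.symm, absurd rfl hij]
  have h1 : (SimpleGraph.cycleGraph 4).Adj 0 1 := by decide
  have h2 : (SimpleGraph.cycleGraph 4).Adj 2 3 := by decide
  have h3 : (SimpleGraph.cycleGraph 4).Adj 1 2 := by decide
  have h4 : (SimpleGraph.cycleGraph 4).Adj 3 0 := by decide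
  by_cases h01 : R.Adj 0 1
  · by_cases h12 : R.Adj 1 2
    · exact Or.inl (hred 1 0 2 (by decide) h01.symm h12)
    · by_cases h30 : R.Adj 3 0
      · exact Or.inl (hred 0 1 3 (by decide) h01 h30.symm)
      · exact Or.inr (hblue 1 2 3 0 (by decide) (by decide) (by decide) (by decide) h3 h4 h12 h30)
  · by_cases h23 : R.Adj 2 3
    · by_cases h12 : R.Adj 1 2
      · exact Or.inl (hred 2 1 3 (by decide) h12.symm h23)
      · by_cases h30 : R.Adj 3 0
        · exact Or.inl (hred 3 2 0 (by decide) h23.symm h30)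
        · exact Or.inr (hblue 1 2 3 0 (by decide) (by decide) (by decide) (by decide) h3 h4 h12 h30)
    · exact Or.inr (hblue 0 1 2 3 (by decide) (by decide) (by decide) (by decide) h1 h2 h01 h23)

/-! ### From components to isomorphisms -/

/-- The range is connected and no edge leaves it, so it is a whole component. -/
theorem exists_embedding_range_eq_supp {G : SimpleGraph V} {H : SimpleGraph W} {φ : W → V}
    (hφ : Function.Injective φ) (hadj : ∀ a b, G.Adj (φ a) (φ b) ↔ H.Adj a b)
    (hH : H.Preconnected) (hcl : ∀ w b, G.Adj (φ w) b → b ∈ Set.range φ) (w : W) :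
    ∃ f : H ↪g G, Set.range f = (G.connectedComponentMk (φ w)).supp := by
  let f : H ↪g G := ⟨⟨φ, hφ⟩, hadj _ _⟩
  refine ⟨f, Set.ext fun b => ?_⟩
  rw [SimpleGraph.ConnectedComponent.mem_supp_iff, SimpleGraph.ConnectedComponent.eq]
  constructor
  · rintro ⟨x, rfl⟩
    exact (hH x w).map f.toHom
  · intro h
    obtain ⟨p⟩ := h.symm
    have : ∀ {a b} (p : G.Walk a b), a ∈ Set.range φ → b ∈ Set.range φ := by
      intro a b p
      induction p with
      | nil => exact id
      | cons hab _ ih =>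
        rintro ⟨x, rfl⟩
        exact ih (hcl x _ hab)
    exact this p ⟨w, rfl⟩

/-- A graph with two types of components. -/
theorem exists_iso_copies [Finite V] {W' : Type*} (G : SimpleGraph V) (A : SimpleGraph W)
    (B : SimpleGraph W')
    (h : ∀ v, (∃ f : A ↪g G, Set.range f = (G.connectedComponentMk v).supp) ∨
      ∃ f : B ↪g G, Set.range f = (G.connectedComponentMk v).supp) :
    ∃ a b, Nonempty (G ≃g copies a A ⊕g copies b B) := by
  classical
  have : Finite G.ConnectedComponent := Quot.finite _
  let P : G.ConnectedComponent → Prop := fun K => ∃ f : A ↪g G, Set.range f = K.supp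
  have hP : ∀ K, ¬ P K → ∃ f : B ↪g G, Set.range f = K.supp := by
    intro K hK
    induction K using SimpleGraph.ConnectedComponent.ind with
    | h v => exact (h v).resolve_left hK
  let e₁ := Finite.equivFin {K // P K}
  let e₂ := Finite.equivFin {K // ¬ P K}
  choose f hf using fun K : {K // P K} => K.2
  choose g hg using fun K : {K // ¬ P K} => hP K.1 K.2
  let Φ : (Fin _ × W) ⊕ (Fin _ × W') → V :=
    Sum.elim (fun x => f (e₁.symm x.1) x.2) (fun x => g (e₂.symm x.1) x.2)
  have hf' : ∀ K w, G.connectedComponentMk (f K w) = K.1 := fun K w => by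
    rw [← SimpleGraph.ConnectedComponent.mem_supp_iff, ← hf]
    exact ⟨w, rfl⟩
  have hg' : ∀ K w, G.connectedComponentMk (g K w) = K.1 := fun K w => by
    rw [← SimpleGraph.ConnectedComponent.mem_supp_iff, ← hg]
    exact ⟨w, rfl⟩
  have hfg : ∀ K K' w w', G.connectedComponentMk (f K w) ≠ G.connectedComponentMk (g K' w') := by
    intro K K' w w' h
    rw [hf', hg'] at h
    exact K'.2 (h ▸ K.2)
  have hadj : ∀ {a b}, G.Adj a b → G.connectedComponentMk a = G.connectedComponentMk b :=
    fun h => SimpleGraph.ConnectedComponent.sound h.reachable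
  have hinj : Function.Injective Φ := by
    rintro (⟨i, x⟩ | ⟨i, x⟩) (⟨j, y⟩ | ⟨j, y⟩) hxy
    · have hij : i = j := e₁.symm.injective (Subtype.ext (by
        rw [← hf' _ x, ← hf' _ y]; exact congrArg _ hxy))
      subst hij
      rw [(f (e₁.symm i)).injective (show f (e₁.symm i) x = f (e₁.symm i) y from hxy)]
    · exact absurd (congrArg _ hxy) (hfg _ _ x y)
    · exact absurd (congrArg _ hxy.symm) (hfg _ _ y x)
    · have hij : i = j := e₂.symm.injective (Subtype.ext (by
        rw [← hg' _ x, ← hg' _ y]; exact congrArg _ hxy))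
      subst hij
      rw [(g (e₂.symm i)).injective (show g (e₂.symm i) x = g (e₂.symm i) y from hxy)]
  have hsurj : Function.Surjective Φ := by
    intro v
    by_cases hv : P (G.connectedComponentMk v)
    · have : v ∈ Set.range (f ⟨_, hv⟩) := by rw [hf]; rfl
      obtain ⟨w, hw⟩ := this
      exact ⟨.inl (e₁ ⟨_, hv⟩, w), by simp [Φ, hw]⟩
    · have : v ∈ Set.range (g ⟨_, hv⟩) := by rw [hg]; rfl
      obtain ⟨w, hw⟩ := this
      exact ⟨.inr (e₂ ⟨_, hv⟩, w), by simp [Φ, hw]⟩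
  refine ⟨_, _, ⟨SimpleGraph.Iso.symm ⟨Equiv.ofBijective Φ ⟨hinj, hsurj⟩, ?_⟩⟩⟩
  rintro (⟨i, x⟩ | ⟨i, x⟩) (⟨j, y⟩ | ⟨j, y⟩)
  · rw [SimpleGraph.sum_adj_inl]
    constructor
    · intro h
      have hij : i = j := e₁.symm.injective (Subtype.ext (by
        rw [← hf' _ x, ← hf' _ y]; exact hadj h))
      subst hij
      exact ⟨rfl, (f (e₁.symm i)).map_adj_iff.1 h⟩
    · rintro ⟨hij, h⟩
      obtain rfl : i = j := hij
      exact (f (e₁.symm i)).map_adj_iff.2 h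
  · exact ⟨fun h => absurd (hadj h) (hfg _ _ x y), fun h => by simp at h⟩
  · exact ⟨fun h => absurd (hadj h.symm) (hfg _ _ y x), fun h => by simp at h⟩
  · rw [SimpleGraph.sum_adj_inr]
    constructor
    · intro h
      have hij : i = j := e₂.symm.injective (Subtype.ext (by
        rw [← hg' _ x, ← hg' _ y]; exact hadj h))
      subst hij
      exact ⟨rfl, (g (e₂.symm i)).map_adj_iff.1 h⟩
    · rintro ⟨hij, h⟩
      obtain rfl : i = j := hij
      exact (g (e₂.symm i)).map_adj_iff.2 h

theorem StarAt.exists_embedding [Finite V] {G : SimpleGraph V} {N : ℕ} {c v : V}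
    (h : StarAt G N c) (hv : v = c ∨ G.Adj c v) :
    ∃ f : star N ↪g G, Set.range f = (G.connectedComponentMk v).supp := by
  obtain ⟨hN, hl⟩ := h
  have e : Fin N ≃ G.neighborSet c := (Finite.equivFinOfCardEq hN).symm
  have hadj : ∀ i, G.Adj c (e i) := fun i => (e i).2
  have hnadj : ∀ i j, ¬ G.Adj (e i) (e j) := by
    intro i j h
    have : (e j : V) ∈ G.neighborSet (e i) := h
    rw [hl _ (hadj i)] at this
    exact (hadj j).ne this.symm
  have hcenter : ∀ x : Fin 1 ⊕ Fin N, (star N).Reachable x (.inl 0) := by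
    rintro (a | a)
    · rw [Subsingleton.elim a 0]
    · exact SimpleGraph.Adj.reachable (by simp)
  have hv' : G.connectedComponentMk c = G.connectedComponentMk v := by
    rcases hv with rfl | hv
    · rfl
    · exact SimpleGraph.ConnectedComponent.sound hv.reachable
  rw [← hv']
  refine exists_embedding_range_eq_supp (φ := Sum.elim (fun _ => c) (fun i => (e i : V))) ?_ ?_
    (fun x y => (hcenter x).trans (hcenter y).symm) ?_ (.inl 0)
  · rintro (a | a) (b | b) hab
    · rw [Subsingleton.elim a b]
    · exact absurd hab (hadj b).ne
    · exact absurd hab (hadj a).ne'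
    · rw [e.injective (Subtype.ext hab)]
  · rintro (a | a) (b | b)
    · simp
    · simpa using hadj b
    · simpa using (hadj a).symm
    · simpa using hnadj a b
  · rintro (a | a) b hb
    · exact ⟨.inr (e.symm ⟨b, hb⟩), by simp⟩
    · have : b ∈ G.neighborSet (e a) := hb
      rw [hl _ (hadj a)] at this
      exact ⟨.inl 0, this.symm⟩

theorem TriangleAt.exists_embedding {G : SimpleGraph V} {x y z : V} (h : TriangleAt G x y z) :
    ∃ f : SimpleGraph.completeGraph (Fin 3) ↪g G,
      Set.range f = (G.connectedComponentMk x).supp := by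
  obtain ⟨h1, h2, h3⟩ := h
  have mem : ∀ a b, G.Adj a b ↔ b ∈ G.neighborSet a := fun _ _ => Iff.rfl
  have hxy : G.Adj x y := by rw [mem, h1]; simp
  have hxz : G.Adj x z := by rw [mem, h1]; simp
  have hyz : G.Adj y z := by rw [mem, h2]; simp
  have hr : Set.range ![x, y, z] = {x, y, z} := by
    ext b
    simp [eq_comm]
    tauto
  have hyz' := hyz.ne
  refine exists_embedding_range_eq_supp (φ := ![x, y, z]) ?_ ?_ (fun i j => ?_) ?_ 0
  · intro i j hij
    have := hxy.ne
    have := hxz.ne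
    fin_cases i <;> fin_cases j <;> simp_all
  · intro i j
    fin_cases i <;> fin_cases j <;> simp [hxy, hxz, hyz, hxy.symm, hxz.symm, hyz.symm]
  · by_cases hij : i = j
    · rw [hij]
    · exact SimpleGraph.Adj.reachable hij
  · intro i b hb
    rw [mem] at hb
    rw [hr]
    fin_cases i
    · exact Or.inr (h1 ▸ hb)
    · rcases (h2 ▸ hb : b ∈ ({x, z} : Set V)) with hb | hb
      exacts [Or.inl hb, Or.inr (Or.inr hb)]
    · rcases (h3 ▸ hb : b ∈ ({x, y} : Set V)) with hb | hb
      exacts [Or.inl hb, Or.inr (Or.inl hb)]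

theorem FourCycleAt.exists_embedding {G : SimpleGraph V} {x y z w : V} (h : FourCycleAt G x y z w) :
    ∃ f : SimpleGraph.cycleGraph 4 ↪g G, Set.range f = (G.connectedComponentMk x).supp := by
  obtain ⟨hxz, hyw, h1, h2, h3, h4⟩ := h
  have mem : ∀ a b, G.Adj a b ↔ b ∈ G.neighborSet a := fun _ _ => Iff.rfl
  have hxy : G.Adj x y := by rw [mem, h1]; simp
  have hxw : G.Adj x w := by rw [mem, h1]; simp
  have hyz : G.Adj y z := by rw [mem, h2]; simp
  have hzw : G.Adj z w := by rw [mem, h3]; simp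
  have hnxz : ¬ G.Adj x z := by
    rw [mem, h1]
    rintro (h | h)
    exacts [hyz.ne h.symm, hzw.ne h]
  have hnyw : ¬ G.Adj y w := by
    rw [mem, h2]
    rintro (h | h)
    exacts [hxw.ne h.symm, hzw.ne h.symm]
  have hr : Set.range ![x, y, z, w] = {x, y, z, w} := by
    ext b
    simp [eq_comm]
    tauto
  refine exists_embedding_range_eq_supp (φ := ![x, y, z, w]) ?_ ?_
    SimpleGraph.cycleGraph_preconnected ?_ 0
  · intro i j hij
    have := hxy.ne
    have := hxw.ne
    have := hyz.ne
    have := hzw.ne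
    fin_cases i <;> fin_cases j <;> simp_all
  · intro i j
    have hnzx : ¬ G.Adj z x := fun h => hnxz h.symm
    have hnwy : ¬ G.Adj w y := fun h => hnyw h.symm
    fin_cases i <;> fin_cases j <;>
      simp [SimpleGraph.cycleGraph_adj, hxy, hxw, hyz, hzw, hxy.symm, hxw.symm, hyz.symm, hzw.symm,
        hnxz, hnyw, hnzx, hnwy] <;> decide
  · intro i b hb
    rw [mem] at hb
    rw [hr]
    fin_cases i
    · rcases (h1 ▸ hb : b ∈ ({y, w} : Set V)) with hb | hb
      exacts [Or.inr (Or.inl hb), Or.inr (Or.inr (Or.inr hb))]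
    · rcases (h2 ▸ hb : b ∈ ({x, z} : Set V)) with hb | hb
      exacts [Or.inl hb, Or.inr (Or.inr (Or.inl hb))]
    · rcases (h3 ▸ hb : b ∈ ({y, w} : Set V)) with hb | hb
      exacts [Or.inr (Or.inl hb), Or.inr (Or.inr (Or.inr hb))]
    · rcases (h4 ▸ hb : b ∈ ({x, z} : Set V)) with hb | hb
      exacts [Or.inl hb, Or.inr (Or.inr (Or.inl hb))]

end DisjointUnions
-- The size Ramsey number and the extremal graphs
section Extremal

variable {V : Type*}

/-- A graph all of whose components are stars. -/
theorem exists_iso_copies_star [Finite V] {G : SimpleGraph V} {N : ℕ}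
    (h : ∀ v, ∃ c, StarAt G N c ∧ (v = c ∨ G.Adj c v)) :
    ∃ a, Nonempty (G ≃g copies a (star N)) := by
  obtain ⟨a, b, ⟨e⟩⟩ := exists_iso_copies G (star N) (star N) fun v => by
    obtain ⟨c, hc, hv⟩ := h v
    exact Or.inl (hc.exists_embedding hv)
  exact ⟨a + b, ⟨e.trans (copiesAddIso a b _)⟩⟩

theorem sizeRamseyNumber_eq {s t m n : ℕ} (hs : 0 < s) (ht : 0 < t) (hm : 0 < m) (hmn : m ≤ n) :
    sizeRamseyNumber (copies s (star n)) (copies t (star m)) = (s + t - 1) * (n + m - 1) := by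
  have hmem : (s + t - 1) * (n + m - 1) ∈ {k | ∃ (N : ℕ) (G : SimpleGraph (Fin N)),
      Arrows G (copies s (star n)) (copies t (star m)) ∧ G.edgeSet.ncard = k} := by
    have e := (copies (s + t - 1) (star (n + m - 1))).overFinIso rfl
    refine ⟨_, _, (arrows_iff _ _ _ _ _).2 ((arrowsAll_copies arrowsStars_star (s + t - 1) s t
      (by omega)).iso e), ?_⟩
    rw [← ncard_edgeSet_congr e, ncard_edgeSet_copies, ncard_edgeSet_star]
  refine le_antisymm (Nat.sInf_le hmem) (le_csInf ⟨_, hmem⟩ ?_)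
  rintro k ⟨N, G, hG, rfl⟩
  exact (ArrowsStars.le_ncard_edgeSet hm hmn (s + t - 1) s t hs ht (by omega) G
    ((arrows_iff _ _ _ _ _).1 hG)).1

/-- The local structure gives the types of components, and the number of edges then determines how
many copies occur. -/
theorem exists_iso_of_arrowsStars [Finite V] {s t m n : ℕ} (hs : 0 < s) (ht : 0 < t) (hm : 0 < m)
    (hmn : m ≤ n) {G : SimpleGraph V} (hG : ∀ v, ∃ w, G.Adj v w) (h : ArrowsStars G n m s t)
    (heq : G.edgeSet.ncard = (s + t - 1) * (n + m - 1)) :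
    Nonempty (G ≃g copies (s + t - 1) (star (n + m - 1))) ∨
      (n = 2 ∧ m = 2 ∧ ∃ l ≤ s + t - 1, Nonempty
        (G ≃g copies l (SimpleGraph.completeGraph (Fin 3)) ⊕g copies (s + t - 1 - l) (star 3))) ∨
      (s = 1 ∧ m = 1 ∧ n = 2 ∧ ∃ l, 2 * l ≤ t ∧ Nonempty
        (G ≃g copies l (SimpleGraph.cycleGraph 4) ⊕g copies (t - 2 * l) (star 2))) := by
  have hloc := fun v => (ArrowsStars.le_ncard_edgeSet hm hmn (s + t - 1) s t hs ht (by omega) G h).2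
    heq v (hG v)
  by_cases h1 : n = 2 ∧ m = 2
  · obtain ⟨rfl, rfl⟩ := h1
    obtain ⟨a, b, ⟨e⟩⟩ := exists_iso_copies G (SimpleGraph.completeGraph (Fin 3)) (star 3)
      fun v => by
        rcases hloc v with ⟨c, hc, hv⟩ | ⟨-, -, y, z, hv⟩ | ⟨-, h, -⟩
        · exact Or.inr (hc.exists_embedding hv)
        · exact Or.inl hv.exists_embedding
        · omega
    rw [ncard_edgeSet_congr e, ncard_edgeSet_sum, ncard_edgeSet_copies, ncard_edgeSet_copies,
      ncard_edgeSet_triangle, ncard_edgeSet_star] at heq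
    obtain rfl : b = s + t - 1 - a := by omega
    exact Or.inr (Or.inl ⟨rfl, rfl, a, by omega, ⟨e⟩⟩)
  by_cases h2 : s = 1 ∧ m = 1 ∧ n = 2
  · obtain ⟨rfl, rfl, rfl⟩ := h2
    obtain ⟨a, b, ⟨e⟩⟩ := exists_iso_copies G (SimpleGraph.cycleGraph 4) (star 2)
      fun v => by
        rcases hloc v with ⟨c, hc, hv⟩ | ⟨-, h, -⟩ | ⟨-, -, y, z, w, hv⟩
        · exact Or.inr (hc.exists_embedding hv)
        · omega
        · exact Or.inl hv.exists_embedding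
    rw [ncard_edgeSet_congr e, ncard_edgeSet_sum, ncard_edgeSet_copies, ncard_edgeSet_copies,
      ncard_edgeSet_fourCycle, ncard_edgeSet_star] at heq
    obtain rfl : b = t - 2 * a := by omega
    exact Or.inr (Or.inr ⟨rfl, rfl, rfl, a, by omega, ⟨e⟩⟩)
  · obtain ⟨a, ⟨e⟩⟩ := exists_iso_copies_star (G := G) (N := n + m - 1) fun v => by
      rcases hloc v with hv | ⟨hn, hm, -⟩ | ⟨rfl, rfl, y, z, w, hv⟩
      · exact hv
      · exact absurd ⟨hn, hm⟩ h1
      -- Here `n = 2` and `m = 1`, so `h2` leaves only `s ≥ 2`.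
      · exact absurd hv (h.not_fourCycleAt (by omega) ht heq v y z w)
    rw [ncard_edgeSet_congr e, ncard_edgeSet_copies, ncard_edgeSet_star] at heq
    obtain rfl : a = s + t - 1 := Nat.eq_of_mul_eq_mul_right (by omega) heq
    exact Or.inl ⟨e⟩

/-- The graphs that attain the size Ramsey number. -/
theorem arrows_and_ncard_eq_iff [Finite V] {s t m n : ℕ} (hs : 0 < s) (ht : 0 < t) (hm : 0 < m)
    (hmn : m ≤ n) {G : SimpleGraph V} (hG : ∀ v, ∃ w, G.Adj v w) :
    (Arrows G (copies s (star n)) (copies t (star m)) ∧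
        G.edgeSet.ncard = (s + t - 1) * (n + m - 1)) ↔
      Nonempty (G ≃g copies (s + t - 1) (star (n + m - 1))) ∨
      (n = 2 ∧ m = 2 ∧ ∃ l ≤ s + t - 1, Nonempty
        (G ≃g copies l (SimpleGraph.completeGraph (Fin 3)) ⊕g copies (s + t - 1 - l) (star 3))) ∨
      (s = 1 ∧ m = 1 ∧ n = 2 ∧ ∃ l, 2 * l ≤ t ∧ Nonempty
        (G ≃g copies l (SimpleGraph.cycleGraph 4) ⊕g copies (t - 2 * l) (star 2))) := by
  rw [arrows_iff]
  constructor
  · rintro ⟨h, heq⟩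
    exact exists_iso_of_arrowsStars hs ht hm hmn hG h heq
  · rintro (⟨⟨e⟩⟩ | ⟨rfl, rfl, l, hl, ⟨e⟩⟩ | ⟨rfl, rfl, rfl, l, hl, ⟨e⟩⟩)
    · refine ⟨(arrowsAll_copies arrowsStars_star (s + t - 1) s t (by omega)).iso e.symm, ?_⟩
      rw [ncard_edgeSet_congr e, ncard_edgeSet_copies, ncard_edgeSet_star]
    · refine ⟨((arrowsAll_copies arrowsStars_triangle l).sum (arrowsAll_copies
        (arrowsStars_star (n := 2) (m := 2)) (s + t - 1 - l)) s t (by omega)).iso e.symm, ?_⟩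
      rw [ncard_edgeSet_congr e, ncard_edgeSet_sum, ncard_edgeSet_copies, ncard_edgeSet_copies,
        ncard_edgeSet_triangle, ncard_edgeSet_star]
      omega
    · have h := (arrowsStars_copies arrowsStars_fourCycle l).sum
        (arrowsStars_copies (arrowsStars_star (n := 2) (m := 1)) (t - 2 * l))
      rw [show 2 * l + 1 * (t - 2 * l) = t by omega] at h
      refine ⟨h.iso e.symm, ?_⟩
      rw [ncard_edgeSet_congr e, ncard_edgeSet_sum, ncard_edgeSet_copies, ncard_edgeSet_copies,
        ncard_edgeSet_fourCycle, ncard_edgeSet_star]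
      omega

end Extremal

end SizeRamsey

theorem theorem2 (s t m n : ℕ) (hs : 0 < s) (ht : 0 < t) (hm : 0 < m) (hn : 0 < n)
    (hmn : m ≤ n) :
    SizeRamsey.sizeRamseyNumber
        (SizeRamsey.copies s (SizeRamsey.star n)) (SizeRamsey.copies t (SizeRamsey.star m)) =
      (s + t - 1) * (m + n - 1) ∧
    ∀ (V : Type*) [Finite V] (G : SimpleGraph V), (∀ v, ∃ w, G.Adj v w) →
      ((SizeRamsey.Arrows G
            (SizeRamsey.copies s (SizeRamsey.star n)) (SizeRamsey.copies t (SizeRamsey.star m)) ∧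
          G.edgeSet.ncard = (s + t - 1) * (m + n - 1)) ↔
        (Nonempty (G ≃g SizeRamsey.copies (s + t - 1) (SizeRamsey.star (n + m - 1))) ∨
          (n = 2 ∧ m = 2 ∧ ∃ l ≤ s + t - 1,
            Nonempty (G ≃g SizeRamsey.copies l (SimpleGraph.completeGraph (Fin 3)) ⊕g
              SizeRamsey.copies (s + t - 1 - l) (SizeRamsey.star 3))) ∨
          (s = 1 ∧ m = 1 ∧ n = 2 ∧ ∃ l, 2 * l ≤ t ∧
            Nonempty (G ≃g SizeRamsey.copies l (SimpleGraph.cycleGraph 4) ⊕g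
              SizeRamsey.copies (t - 2 * l) (SizeRamsey.star 2))))) := by
  rw [add_comm m n]
  exact ⟨SizeRamsey.sizeRamseyNumber_eq hs ht hm hmn, fun V _ G hG =>
    SizeRamsey.arrows_and_ncard_eq_iff hs ht hm hmn hG⟩
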